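/- Let $F$ be Thompson's group of orientation-preserving piecewise-linear homeomorphisms of $[0,1]$ whose slopes are powers of $2$ and whose finitely many breakpoints have dyadic rational coordinates. Products are written as in $(fg)(t)=g(f(t))$. Let $x_0\in F$ map $[0,\frac14],[\frac14,\frac12],[\frac12,1]$ linearly onto $[0,\frac12],[\frac12,\frac34],[\frac34,1]$. Let $x_1\in F$ be the identity on $[0,\frac12]$ and map $[\frac12,\frac58],[\frac58,\frac34],[\frac34,1]$ linearly onto $[\frac12,\frac34],[\frac34,\frac78],[\frac78,1]$. For $S\subset F$ let $\delta S$ be the set of edges between $S$ and its complement in the Cayley graph of $F$ with respect to $\{x_0,x_1\}$, whose edges join $f$ to $x_if$. The isoperimetric (Cheeger) constant is $$\iota(F,\{x_0,x_1\})=\inf\{|\delta S|/|S| : S\subset F \text{ finite and nonempty}\}.$$ An element of $F$ is positive if the bottom (range) tree of its reduced tree diagram is a right vine, that is, a binary tree in which every left child is a leaf. Conjugation by the piecewise-linear homeomorphism $\psi\colon\mathbb R\to(0,1)$ that is linear on each $[i,i+1]$, $i\in\mathbb Z$, with $\psi(i)=1-2^{-(i+1)}$ for $i\ge 0$ and $\psi(i)=2^{i-1}$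 for $i<0$, turns $F$ into a group of homeomorphisms of $\mathbb R$. Each $f\in F$ then has a unique reduced two-way forest diagram. It consists of two forests $(T_i)_{i\in\mathbb Z}$, $(U_i)_{i\in\mathbb Z}$ of finite binary trees, all but finitely many of them trivial, with pointers at $T_0$ and $U_0$, and an order-preserving bijection of their leaves, such that $\psi f\psi^{-1}$ maps the dyadic intervals belonging to the leaves of the first forest linearly onto those belonging to the matching leaves of the second, and no two carets oppose each other. Its support is the smallest interval of leaves containing both pointers and all nontrivial trees, and its width is the number of spaces between consecutive leaves of the support. The height of a tree is the length of a longest descending path from the root to a leaf. For $n,k\ge 0$ let $S_{n,k}$ be the set of all positive elements whose forest diagram has width at most $n$ and all of whose trees have height at most $k$. Let $t_k(p)=\sum_{\ell\ge1}t_{\ell,k}\,p^\ell$, where $t_{\ell,k}$ is the number of binary trees with $\ell$ leaves and height at most $k$. Theorem. $\iota(F,\{x_0,x_1\})\le \frac12$. More precisely, every $S_{n,k}$ is finite and nonempty. For every $k\ge0$ the equation $t_k(p)=1$ has a unique positive root $p_k$, and $$\lim_{n\to\infty}\frac{|\delta S_{n,k}|}{|S_{n,k}|}=2p_k .$$ Moreover,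 $\lim_{k\to\infty}p_k=\frac14$. -/

import Mathlib

open Filter Topology

/-! ## The isoperimetric constant of a group -/

/-- The set `δS` of edges between `S` and its complement in the Cayley graph of `G` with respect
to `gens` (vertices `g`, edges joining `g` and `g * x` for `x ∈ gens`). -/
def edgeBoundary {G : Type*} [Group G] (gens S : Set G) : Set (Sym2 G) :=
  {e | e ∈ (SimpleGraph.mulCayley gens).edgeSet ∧ ∃ a ∈ S, ∃ b ∉ S, e = s(a, b)}

/-- The ratio `|δS| / |S|`. -/
noncomputable def boundaryRatio {G : Type*} [Group G] (gens S : Set G) : ℝ :=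
  ((edgeBoundary gens S).ncard : ℝ) / (S.ncard : ℝ)

/-- The isoperimetric constant: the infimum of `|δS| / |S|` over the finite nonempty `S ⊆ G`. -/
noncomputable def isoperimetricConstant {G : Type*} [Group G] (gens : Set G) : ℝ :=
  sInf {r : ℝ | ∃ S : Set G, S.Finite ∧ S.Nonempty ∧ r = boundaryRatio gens S}

namespace Thompson

/-! ## Thompson's group `F` -/

/-- Dyadic rational numbers. -/
def IsDyadic (x : ℝ) : Prop := ∃ (a : ℤ) (n : ℕ), x = a / 2 ^ n

/-- An orientation-preserving homeomorphism `f` of `[0,1]` that is piecewise linear, with finitely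
many breakpoints, all with dyadic coordinates `(b, f b)`, and with all linear pieces of the form
`y ↦ 2 ^ m * y + c`, `m` an integer. (The constant `c` is then automatically dyadic.) -/
def IsDyadicRearrangement (f : unitInterval ≃o unitInterval) : Prop :=
  ∃ B : Set unitInterval, B.Finite ∧
    (∀ b ∈ B, IsDyadic (b : ℝ) ∧ IsDyadic (f b : ℝ)) ∧
    ∀ x ∉ B, ∃ (m : ℤ) (c : ℝ), IsDyadic c ∧
      ∀ᶠ y : unitInterval in 𝓝 x, (f y : ℝ) = (2 : ℝ) ^ m * (y : ℝ) + c

theorem IsDyadic.add {x y : ℝ} (hx : IsDyadic x) (hy : IsDyadic y) : IsDyadic (x + y) := by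
  obtain ⟨a, n, rfl⟩ := hx
  obtain ⟨b, k, rfl⟩ := hy
  refine ⟨a * 2 ^ k + b * 2 ^ n, n + k, ?_⟩
  push_cast
  rw [pow_add]
  field_simp

theorem IsDyadic.neg {x : ℝ} (hx : IsDyadic x) : IsDyadic (-x) := by
  obtain ⟨a, n, rfl⟩ := hx
  exact ⟨-a, n, by push_cast; ring⟩

theorem IsDyadic.mul {x y : ℝ} (hx : IsDyadic x) (hy : IsDyadic y) : IsDyadic (x * y) := by
  obtain ⟨a, n, rfl⟩ := hx
  obtain ⟨b, k, rfl⟩ := hy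
  refine ⟨a * b, n + k, ?_⟩
  push_cast
  rw [pow_add]
  field_simp

theorem isDyadic_zpow (m : ℤ) : IsDyadic ((2 : ℝ) ^ m) := by
  obtain ⟨n, rfl | rfl⟩ := m.eq_nat_or_neg
  · exact ⟨2 ^ n, 0, by simp⟩
  · exact ⟨1, n, by simp⟩

theorem isDyadic_zero : IsDyadic 0 := ⟨0, 0, by simp⟩

theorem IsDyadicRearrangement.isDyadic_apply {f : unitInterval ≃o unitInterval}
    (hf : IsDyadicRearrangement f) {x : unitInterval} (hx : IsDyadic (x : ℝ)) :
    IsDyadic (f x : ℝ) := by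
  obtain ⟨B, -, hB, h⟩ := hf
  by_cases hxB : x ∈ B
  · exact (hB x hxB).2
  · obtain ⟨m, c, hc, he⟩ := h x hxB
    rw [he.self_of_nhds]
    exact ((isDyadic_zpow m).mul hx).add hc

theorem IsDyadicRearrangement.mul {f g : unitInterval ≃o unitInterval}
    (hf : IsDyadicRearrangement f) (hg : IsDyadicRearrangement g) :
    IsDyadicRearrangement (f * g) := by
  have hfd := fun {x} => hf.isDyadic_apply (x := x)
  obtain ⟨A, hA, hA1, hA2⟩ := hf
  obtain ⟨B, hB, hB1, hB2⟩ := id hg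
  refine ⟨B ∪ {x | g x ∈ A}, ?_, ?_, ?_⟩
  · exact hB.union (hA.preimage g.injective.injOn)
  · have key : ∀ x, g x ∈ A → IsDyadic (x : ℝ) := by
      intro x hx
      by_cases hxB : x ∈ B
      · exact (hB1 x hxB).1
      · obtain ⟨m, c, hc, he⟩ := hB2 x hxB
        have h1 := he.self_of_nhds
        have h2 : (x : ℝ) = (2 : ℝ) ^ (-m) * ((g x : ℝ) + -c) := by
          rw [h1, zpow_neg]
          field_simp
          ring
        rw [h2]
        exact (isDyadic_zpow _).mul ((hA1 _ hx).1.add hc.neg)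
    rintro x (hx | hx)
    · exact ⟨(hB1 x hx).1, hfd (hB1 x hx).2⟩
    · exact ⟨key x hx, (hA1 _ hx).2⟩
  · intro x hx
    simp only [Set.mem_union, Set.mem_ofPred_eq, not_or] at hx
    obtain ⟨m, c, hc, he⟩ := hB2 x hx.1
    obtain ⟨m', c', hc', he'⟩ := hA2 (g x) hx.2
    refine ⟨m' + m, (2 : ℝ) ^ m' * c + c', ((isDyadic_zpow m').mul hc).add hc', ?_⟩
    have hcont : Continuous g := g.continuous
    filter_upwards [he, hcont.continuousAt.eventually he'] with y h1 h2
    rw [RelIso.mul_apply, h2, h1, zpow_add₀ (by norm_num)]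
    ring

theorem IsDyadicRearrangement.inv {f : unitInterval ≃o unitInterval}
    (hf : IsDyadicRearrangement f) : IsDyadicRearrangement f⁻¹ := by
  obtain ⟨A, hA, hA1, hA2⟩ := hf
  refine ⟨f '' A, hA.image f, ?_, ?_⟩
  · rintro _ ⟨a, ha, rfl⟩
    rw [RelIso.inv_apply_self]
    exact ⟨(hA1 a ha).2, (hA1 a ha).1⟩
  · intro x hx
    have hx' : f⁻¹ x ∉ A := fun h => hx ⟨_, h, RelIso.apply_inv_self f x⟩
    obtain ⟨m, c, hc, he⟩ := hA2 _ hx'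
    refine ⟨-m, -((2 : ℝ) ^ (-m) * c), ((isDyadic_zpow _).mul hc).neg, ?_⟩
    have hcont : Continuous (f⁻¹ : unitInterval ≃o unitInterval) := OrderIso.continuous _
    filter_upwards [hcont.continuousAt.eventually he] with y h
    rw [RelIso.apply_inv_self] at h
    rw [h, zpow_neg]
    field_simp
    ring

/-- Thompson's group `F`, with composition of maps `(f * g) t = f (g t)`. -/
def F : Subgroup (unitInterval ≃o unitInterval) where
  carrier := {f | IsDyadicRearrangement f}
  mul_mem' := IsDyadicRearrangement.mul
  one_mem' := ⟨∅, Set.finite_empty, by simp, fun x _ =>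
    ⟨0, 0, isDyadic_zero, Eventually.of_forall fun y => by simp⟩⟩
  inv_mem' := IsDyadicRearrangement.inv

/-! ## The generators -/

/-- `x₀` sends `[0,1/4]`, `[1/4,1/2]`, `[1/2,1]` linearly onto `[0,1/2]`, `[1/2,3/4]`, `[3/4,1]`. -/
noncomputable def x0Fun (t : ℝ) : ℝ :=
  if t ≤ 1 / 4 then 2 * t else if t ≤ 1 / 2 then t + 1 / 4 else (t + 1) / 2

noncomputable def x0InvFun (t : ℝ) : ℝ :=
  if t ≤ 1 / 2 then t / 2 else if t ≤ 3 / 4 then t - 1 / 4 else 2 * t - 1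

/-- `x₁` is the identity on `[0,1/2]` and sends `[1/2,5/8]`, `[5/8,3/4]`, `[3/4,1]` linearly onto
`[1/2,3/4]`, `[3/4,7/8]`, `[7/8,1]`. -/
noncomputable def x1Fun (t : ℝ) : ℝ :=
  if t ≤ 1 / 2 then t else if t ≤ 5 / 8 then 2 * t - 1 / 2
  else if t ≤ 3 / 4 then t + 1 / 8 else (t + 1) / 2

noncomputable def x1InvFun (t : ℝ) : ℝ :=
  if t ≤ 1 / 2 then t else if t ≤ 3 / 4 then t / 2 + 1 / 4
  else if t ≤ 7 / 8 then t - 1 / 8 else 2 * t - 1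

theorem x0Fun_mem (t : unitInterval) : x0Fun t ∈ unitInterval := by
  obtain ⟨t, h0, h1⟩ := t
  constructor <;> (simp only [x0Fun]; split_ifs <;> linarith)

theorem x0InvFun_mem (t : unitInterval) : x0InvFun t ∈ unitInterval := by
  obtain ⟨t, h0, h1⟩ := t
  constructor <;> (simp only [x0InvFun]; split_ifs <;> linarith)

theorem x0InvFun_x0Fun (t : ℝ) : x0InvFun (x0Fun t) = t := by
  simp only [x0Fun]
  split_ifs <;> simp only [x0InvFun] <;> split_ifs <;> linarith

theorem x0Fun_x0InvFun (t : ℝ) : x0Fun (x0InvFun t) = t := by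
  simp only [x0InvFun]
  split_ifs <;> simp only [x0Fun] <;> split_ifs <;> linarith

theorem x0Fun_strictMono : StrictMono x0Fun := by
  intro s t h
  simp only [x0Fun]
  split_ifs <;> linarith

theorem x1Fun_mem (t : unitInterval) : x1Fun t ∈ unitInterval := by
  obtain ⟨t, h0, h1⟩ := t
  constructor <;> (simp only [x1Fun]; split_ifs <;> linarith)

theorem x1InvFun_mem (t : unitInterval) : x1InvFun t ∈ unitInterval := by
  obtain ⟨t, h0, h1⟩ := t
  constructor <;> (simp only [x1InvFun]; split_ifs <;> linarith)

theorem x1InvFun_x1Fun (t : ℝ) : x1InvFun (x1Fun t) = t := by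
  simp only [x1Fun]
  split_ifs <;> simp only [x1InvFun] <;> split_ifs <;> linarith

theorem x1Fun_x1InvFun (t : ℝ) : x1Fun (x1InvFun t) = t := by
  simp only [x1InvFun]
  split_ifs <;> simp only [x1Fun] <;> split_ifs <;> linarith

theorem x1Fun_strictMono : StrictMono x1Fun := by
  intro s t h
  simp only [x1Fun]
  split_ifs <;> linarith

noncomputable def x0Iso : unitInterval ≃o unitInterval where
  toFun t := ⟨x0Fun t, x0Fun_mem t⟩
  invFun t := ⟨x0InvFun t, x0InvFun_mem t⟩
  left_inv t := Subtype.ext (x0InvFun_x0Fun t)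
  right_inv t := Subtype.ext (x0Fun_x0InvFun t)
  map_rel_iff' := x0Fun_strictMono.le_iff_le

noncomputable def x1Iso : unitInterval ≃o unitInterval where
  toFun t := ⟨x1Fun t, x1Fun_mem t⟩
  invFun t := ⟨x1InvFun t, x1InvFun_mem t⟩
  left_inv t := Subtype.ext (x1InvFun_x1Fun t)
  right_inv t := Subtype.ext (x1Fun_x1InvFun t)
  map_rel_iff' := x1Fun_strictMono.le_iff_le

theorem eventually_coe_lt {x : unitInterval} {a : ℝ} (h : (x : ℝ) < a) :
    ∀ᶠ y : unitInterval in 𝓝 x, (y : ℝ) < a :=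
  continuous_subtype_val.continuousAt.eventually_lt_const h

theorem eventually_lt_coe {x : unitInterval} {a : ℝ} (h : a < (x : ℝ)) :
    ∀ᶠ y : unitInterval in 𝓝 x, a < (y : ℝ) :=
  continuous_subtype_val.continuousAt.eventually_const_lt h

theorem x0Iso_mem : x0Iso ∈ F := by
  refine ⟨{x | (x : ℝ) = 1 / 4 ∨ (x : ℝ) = 1 / 2}, ?_, ?_, ?_⟩
  · have : ({1 / 4, 1 / 2} : Set ℝ).Finite := by simp
    exact (this.preimage Subtype.val_injective.injOn).subset fun x hx => by simpa using hx
  · rintro x (hx | hx)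
    · refine ⟨⟨1, 2, by rw [hx]; norm_num⟩, ⟨1, 1, ?_⟩⟩
      change x0Fun x = _
      rw [hx]; norm_num [x0Fun]
    · refine ⟨⟨1, 1, by rw [hx]; norm_num⟩, ⟨3, 2, ?_⟩⟩
      change x0Fun x = _
      rw [hx]; norm_num [x0Fun]
  · intro x hx
    simp only [Set.mem_ofPred_eq, not_or] at hx
    rcases lt_or_gt_of_ne hx.1 with h1 | h1
    · refine ⟨1, 0, isDyadic_zero, ?_⟩
      filter_upwards [eventually_coe_lt h1] with y hy
      change x0Fun y = _
      rw [x0Fun, if_pos hy.le]; simp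
    rcases lt_or_gt_of_ne hx.2 with h2 | h2
    · refine ⟨0, 1 / 4, ⟨1, 2, by norm_num⟩, ?_⟩
      filter_upwards [eventually_lt_coe h1, eventually_coe_lt h2] with y hy hy'
      change x0Fun y = _
      rw [x0Fun, if_neg hy.not_ge, if_pos hy'.le]; simp
    · refine ⟨-1, 1 / 2, ⟨1, 1, by norm_num⟩, ?_⟩
      filter_upwards [eventually_lt_coe h1, eventually_lt_coe h2] with y hy hy'
      change x0Fun y = _
      rw [x0Fun, if_neg hy.not_ge, if_neg hy'.not_ge, zpow_neg_one]; ring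

theorem x1Iso_mem : x1Iso ∈ F := by
  refine ⟨{x | (x : ℝ) = 1 / 2 ∨ (x : ℝ) = 5 / 8 ∨ (x : ℝ) = 3 / 4}, ?_, ?_, ?_⟩
  · have : ({1 / 2, 5 / 8, 3 / 4} : Set ℝ).Finite := by simp
    exact (this.preimage Subtype.val_injective.injOn).subset fun x hx => by simpa using hx
  · rintro x (hx | hx | hx)
    · refine ⟨⟨1, 1, by rw [hx]; norm_num⟩, ⟨1, 1, ?_⟩⟩
      change x1Fun x = _
      rw [hx]; norm_num [x1Fun]
    · refine ⟨⟨5, 3, by rw [hx]; norm_num⟩, ⟨3, 2, ?_⟩⟩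
      change x1Fun x = _
      rw [hx]; norm_num [x1Fun]
    · refine ⟨⟨3, 2, by rw [hx]; norm_num⟩, ⟨7, 3, ?_⟩⟩
      change x1Fun x = _
      rw [hx]; norm_num [x1Fun]
  · intro x hx
    simp only [Set.mem_ofPred_eq, not_or] at hx
    rcases lt_or_gt_of_ne hx.1 with h1 | h1
    · refine ⟨0, 0, isDyadic_zero, ?_⟩
      filter_upwards [eventually_coe_lt h1] with y hy
      change x1Fun y = _
      rw [x1Fun, if_pos hy.le]; simp
    rcases lt_or_gt_of_ne hx.2.1 with h2 | h2
    · refine ⟨1, -1 / 2, ⟨-1, 1, by norm_num⟩, ?_⟩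
      filter_upwards [eventually_lt_coe h1, eventually_coe_lt h2] with y hy hy'
      change x1Fun y = _
      rw [x1Fun, if_neg hy.not_ge, if_pos hy'.le]; norm_num; ring
    rcases lt_or_gt_of_ne hx.2.2 with h3 | h3
    · refine ⟨0, 1 / 8, ⟨1, 3, by norm_num⟩, ?_⟩
      filter_upwards [eventually_lt_coe h1, eventually_lt_coe h2, eventually_coe_lt h3]
        with y hy hy' hy''
      change x1Fun y = _
      rw [x1Fun, if_neg hy.not_ge, if_neg hy'.not_ge, if_pos hy''.le]; simp
    · refine ⟨-1, 1 / 2, ⟨1, 1, by norm_num⟩, ?_⟩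
      filter_upwards [eventually_lt_coe h1, eventually_lt_coe h2, eventually_lt_coe h3]
        with y hy hy' hy''
      change x1Fun y = _
      rw [x1Fun, if_neg hy.not_ge, if_neg hy'.not_ge, if_neg hy''.not_ge, zpow_neg_one]; ring

/-- The generator `x₀` of `F`. -/
noncomputable def x0 : F := ⟨x0Iso, x0Iso_mem⟩

/-- The generator `x₁` of `F`. -/
noncomputable def x1 : F := ⟨x1Iso, x1Iso_mem⟩

/-! ## Trees and tree diagrams

A finite binary tree is a term of `BinaryTree Unit`; the trivial tree (a single leaf) is `nil`, and
`BinaryTree.height nil = 0`. A tree `T` describes a dyadic subdivision of `[0,1]`: the trivial tree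
leaves the interval uncut, and `node L R` cuts it in half, the halves being subdivided according
to `L` and `R`. Leaves are numbered from left to right, starting with `0`. -/

/-- The homeomorphism from `[0,1]` onto `[0, numLeaves T]` that maps, for each `j`, the interval of
leaf `j` of `T` linearly onto `[j, j+1]`. -/
noncomputable def treeCoord : BinaryTree Unit → ℝ → ℝ
  | .nil, x => x
  | .node _ L R, x =>
      if x ≤ 1 / 2 then treeCoord L (2 * x) else L.numLeaves + treeCoord R (2 * x - 1)

/-- The leaves `j` and `j + 1` of the tree are the two children of one node. -/
def HasCaret : BinaryTree Unit → ℕ → Prop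
  | .nil, _ => False
  | .node _ L R, j =>
      (L = .nil ∧ R = .nil ∧ j = 0) ∨ HasCaret L j ∨
        (L.numLeaves ≤ j ∧ HasCaret R (j - L.numLeaves))

/-- The pair `(T, U)` (top, bottom) is a tree diagram for `f`: the map `f` sends the intervals of
the subdivision `T` linearly onto the intervals of `U`, in order. -/
def IsTreeDiagram (T U : BinaryTree Unit) (f : F) : Prop :=
  T.numLeaves = U.numLeaves ∧
    ∀ t : unitInterval, treeCoord U ((f : unitInterval ≃o unitInterval) t : ℝ) = treeCoord T t

/-- A tree diagram is reduced if it has no opposing pair of carets. -/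
def IsReducedTreeDiagram (T U : BinaryTree Unit) : Prop :=
  ∀ j, ¬ (HasCaret T j ∧ HasCaret U j)

/-- A right vine: a long edge on the right with left edges emanating from it. -/
def IsRightVine : BinaryTree Unit → Prop
  | .nil => True
  | .node _ L R => L = .nil ∧ IsRightVine R

/-- `f` is positive: the bottom tree of its reduced tree diagram is a right vine. -/
def IsPositive (f : F) : Prop :=
  ∃ T U, IsTreeDiagram T U f ∧ IsReducedTreeDiagram T U ∧ IsRightVine U

/-! ## Two-way forest diagrams -/

/-- The piecewise linear homeomorphism `ℝ → (0,1)` that maps, for each integer `i`, `[i, i+1]`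
linearly onto `[1 - 2 ^ (-(i+1)), 1 - 2 ^ (-(i+2))]` if `i ≥ 0`, and onto `[2 ^ (i-1), 2 ^ i]` if
`i < 0`. -/
noncomputable def psi (t : ℝ) : ℝ :=
  if 0 ≤ t then 1 - (2 : ℝ) ^ (-(⌊t⌋ + 1)) + (2 : ℝ) ^ (-(⌊t⌋ + 2)) * Int.fract t
  else (2 : ℝ) ^ (⌊t⌋ - 1) * (1 + Int.fract t)

/-- A bounded two-way binary forest `(…, T₋₁, T₀, T₁, …)`, with the pointer at `T₀`. It describes
the subdivision of `ℝ` in which each `[i, i+1]` is subdivided according to `Tᵢ`. -/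
structure Forest where
  tree : ℤ → BinaryTree Unit
  bounded : {i | tree i ≠ .nil}.Finite

/-- The number of the first leaf of the tree `Tᵢ`, where the leaves of the whole forest are numbered
from left to right by the integers and the first leaf of `T₀` has number `0`. -/
noncomputable def Forest.firstLeaf (T : Forest) (i : ℤ) : ℤ :=
  ∑ j ∈ Finset.Ico 0 i, ((T.tree j).numLeaves : ℤ) -
    ∑ j ∈ Finset.Ico i 0, ((T.tree j).numLeaves : ℤ)

/-- The homeomorphism `ℝ → ℝ` that maps, for each integer `j`, the interval of leaf `j` linearly
onto `[j, j+1]`. -/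
noncomputable def Forest.coord (T : Forest) (t : ℝ) : ℝ :=
  T.firstLeaf ⌊t⌋ + treeCoord (T.tree ⌊t⌋) (Int.fract t)

/-- The leaves `j` and `j + 1` of the forest are the two children of one node. -/
def Forest.HasCaret (T : Forest) (j : ℤ) : Prop :=
  ∃ (i : ℤ) (k : ℕ), Thompson.HasCaret (T.tree i) k ∧ j = T.firstLeaf i + k

/-- A two-way forest diagram: a pair of bounded two-way binary forests with an order-preserving
bijection of their leaves. The bijection is a shift: it matches leaf `j` of the top forest with
leaf `j + shift` of the bottom forest. -/
structure ForestDiagram where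
  top : Forest
  bottom : Forest
  shift : ℤ

namespace ForestDiagram

/-- `D` is a forest diagram for `f`: the homeomorphism of `ℝ` obtained from `f` by conjugation
with `psi` sends each interval of the top subdivision linearly onto the interval of the bottom
subdivision that belongs to the matching leaf. -/
def Represents (D : ForestDiagram) (f : F) : Prop :=
  ∀ (x : unitInterval) (s : ℝ), (x : ℝ) = psi s →
    ∃ t : ℝ, ((f : unitInterval ≃o unitInterval) x : ℝ) = psi t ∧
      D.bottom.coord t = D.top.coord s + D.shift

/-- A forest diagram is reduced if it has no opposing pair of carets. -/
def IsReduced (D : ForestDiagram) : Prop :=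
  ∀ j : ℤ, ¬ (D.top.HasCaret j ∧ D.bottom.HasCaret (j + D.shift))

/-- The interval of leaves from `a` to `b` (in the numbering of the top forest) contains both
pointers and all nontrivial trees of both forests. -/
def SupportedIn (D : ForestDiagram) (a b : ℤ) : Prop :=
  (∀ i, (i = 0 ∨ D.top.tree i ≠ .nil) →
    a ≤ D.top.firstLeaf i ∧ D.top.firstLeaf (i + 1) - 1 ≤ b) ∧
  (∀ i, (i = 0 ∨ D.bottom.tree i ≠ .nil) →
    a + D.shift ≤ D.bottom.firstLeaf i ∧ D.bottom.firstLeaf (i + 1) - 1 ≤ b + D.shift)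

/-- The width: the number of spaces between consecutive leaves in the support, the support being
the minimum interval of leaves containing both pointers and all nontrivial trees. -/
noncomputable def width (D : ForestDiagram) : ℕ :=
  sInf {w : ℕ | ∃ a : ℤ, D.SupportedIn a (a + w)}

/-- All trees of the diagram have height at most `k`. -/
def HeightLE (D : ForestDiagram) (k : ℕ) : Prop :=
  ∀ i, (D.top.tree i).height ≤ k ∧ (D.bottom.tree i).height ≤ k

end ForestDiagram

/-- The set `S_{n,k}` of all positive elements whose (reduced) forest diagram has width at most `n`
and all of whose trees have height at most `k`. -/
def S (n k : ℕ) : Set F :=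
  {f | IsPositive f ∧ ∃ D : ForestDiagram, D.Represents f ∧ D.IsReduced ∧
    D.width ≤ n ∧ D.HeightLE k}

/-! ## The polynomials `t_k` -/

/-- The number `t_{ℓ,k}` of binary trees with `ℓ` leaves and height at most `k`. -/
noncomputable def treeCount (l k : ℕ) : ℕ :=
  {T : BinaryTree Unit | T.numLeaves = l ∧ T.height ≤ k}.ncard

/-- The polynomial `t_k(p) = t_{1,k} p + t_{2,k} p ^ 2 + t_{3,k} p ^ 3 + ⋯` (a tree of height at
most `k` has at most `2 ^ k` leaves, so the remaining coefficients vanish). -/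
noncomputable def treePoly (k : ℕ) (p : ℝ) : ℝ :=
  ∑ l ∈ Finset.Icc 1 (2 ^ k), (treeCount l k : ℝ) * p ^ l

end Thompson

namespace Thompson

/-! ## The homeomorphism `psi` -/

/-! In the coordinate `psi` a positive element has a trivial bottom forest, so it is recorded by its
top forest alone. That forest is stored as a zipper: a list `ls` of trees left of the top pointer,
read leftwards and reaching back to the bottom pointer, and a list `rs` of trees from the top
pointer on. Appending trivial trees to `rs` changes nothing (`zipCoord_eq_of_getD_eq`), whereas `ls`
is determined exactly. Every element of `S n k` therefore has a unique zipper with exactly `n + 1`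
leaves and `rs ≠ []` (`mem_S_iff`, `zipElt_injOn`).

The generators act locally. Right multiplication by `x0` moves the top pointer one tree to the right
(`realizes_mul_x0_iff`), and `x1` joins the tree at the pointer and its right neighbour by a caret
(`Realizes.mul_x1`). Hence `x0` leads out of `S n k` exactly when `rs` is a single tree, and `x1⁻¹`
exactly when the tree at the pointer is trivial. A finite set has as many edges leaving along `g` as
along `g⁻¹`, so these two counts, doubled, give the boundary. Write `a m` for the number of lists of
trees of height at most `k` with `m` leaves in all, and `b m = ∑ a i * a (m - i)` for the number of
pairs. Then `|δS| = 2 a (n+1) + 2 b n` and `|S| = b (n+1) - a (n+1)`.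

If `treePoly k p = 1`, then `u n = a n * p ^ n` is a renewal sequence whose steps are the trees `T`,
with length `T.numLeaves` and probability `p ^ T.numLeaves`. The trivial tree is a step of length
one, so `u` converges and stays above a positive constant (`renewal_tendsto`). The self-convolution
`v n = b n * p ^ n` then grows at least linearly with increments `o(n)`, so `v (n+1) / v n → 1` and
`u (n+1) / v n → 0`. The boundary ratio is `2 (u (n+1) + p v n) / (v (n+1) - u (n+1))`, which tends
to `2 p`.

Finally `treePoly (k+1) p = p + treePoly k p ^ 2` iterates `z ↦ z ^ 2 + p`. At `p = 1/4` the
iterates stay below the fixed point `1/2`, and for `p > 1/4` they are unbounded; so the roots tend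
to `1/4`, and `2 p_k` tends to `1/2`. -/

theorem psi_eq_of_mem {t : ℝ} (h0 : -1 ≤ t) (h1 : t ≤ 1) : psi t = 1 / 2 + t / 4 := by
  rcases lt_or_ge t 0 with h | h
  · have hf : ⌊t⌋ = -1 := by rw [Int.floor_eq_iff]; push_cast; constructor <;> linarith
    rw [psi, if_neg (not_le.2 h), Int.fract, hf]
    norm_num
    ring
  · rcases eq_or_lt_of_le h1 with rfl | h1
    · norm_num [psi]
    · have hf : ⌊t⌋ = 0 := by rw [Int.floor_eq_iff]; push_cast; constructor <;> linarith
      rw [psi, if_pos h, Int.fract, hf]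
      norm_num
      ring

/-- With `psi_sub_one` and the linear formula on `[-1, 1]`, this self-similarity replaces the floor
and fractional part in what follows. -/
theorem psi_add_one {t : ℝ} (h : 0 ≤ t) : psi (t + 1) = (1 + psi t) / 2 := by
  rw [psi, if_pos (by linarith), psi, if_pos h, Int.floor_add_one, Int.fract_add_one,
    show (-(⌊t⌋ + 1 + 1) : ℤ) = -(⌊t⌋ + 1) - 1 by ring,
    show (-(⌊t⌋ + 1 + 2) : ℤ) = -(⌊t⌋ + 2) - 1 by ring, zpow_sub_one₀ (by norm_num),
    zpow_sub_one₀ (by norm_num)]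
  ring

theorem psi_sub_one {t : ℝ} (h : t ≤ 0) : psi (t - 1) = psi t / 2 := by
  rcases eq_or_lt_of_le h with rfl | h
  · rw [psi_eq_of_mem (by norm_num) (by norm_num), psi_eq_of_mem (by norm_num) (by norm_num)]
    norm_num
  · rw [psi, if_neg (by linarith), psi, if_neg (by linarith), Int.floor_sub_one,
      Int.fract_sub_one, zpow_sub_one₀ (by norm_num)]
    ring

/-- Induction over the nonnegative reals by unit steps. -/
theorem nonneg_induction {P : ℝ → Prop} (base : ∀ t, 0 ≤ t → t ≤ 1 → P t)
    (step : ∀ t, 0 ≤ t → P t → P (t + 1)) {t : ℝ} (ht : 0 ≤ t) : P t := by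
  have key : ∀ n : ℕ, ∀ t : ℝ, 0 ≤ t → t ≤ n + 1 → P t := by
    intro n
    induction n with
    | zero => intro t h0 h1; exact base t h0 (by simpa using h1)
    | succ n ih =>
      intro t h0 h1
      rcases le_total t 1 with h | h
      · exact base t h0 h
      · have := step (t - 1) (by linarith) (ih (t - 1) (by linarith) (by push_cast at h1; linarith))
        simpa using this
  exact key ⌈t⌉₊ t ht (by linarith [Nat.le_ceil t])

theorem psi_neg {t : ℝ} (h : 0 ≤ t) : psi (-t) = 1 - psi t := by
  refine nonneg_induction (P := fun t => psi (-t) = 1 - psi t) ?_ ?_ h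
  · intro t h0 h1
    rw [psi_eq_of_mem (by linarith) (by linarith), psi_eq_of_mem (by linarith) h1]
    ring
  · intro t h0 ih
    rw [show -(t + 1) = -t - 1 by ring, psi_sub_one (by linarith), psi_add_one h0, ih]
    ring

theorem half_le_psi {t : ℝ} (h : 0 ≤ t) : 1 / 2 ≤ psi t ∧ psi t < 1 := by
  refine nonneg_induction (P := fun t => 1 / 2 ≤ psi t ∧ psi t < 1) ?_ ?_ h
  · intro t h0 h1
    rw [psi_eq_of_mem (by linarith) (by linarith)]
    constructor <;> linarith
  · intro t h0 ih
    rw [psi_add_one h0]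
    constructor <;> linarith

theorem psi_strictMonoOn : StrictMonoOn psi (Set.Ici 0) := by
  intro s hs t ht hst
  simp only [Set.mem_Ici] at hs ht
  refine nonneg_induction (P := fun s => ∀ t, s < t → psi s < psi t) ?_ ?_ hs t hst
  · intro s h0 h1 t hst
    rcases le_total t 1 with h | h
    · rw [psi_eq_of_mem (by linarith) h1, psi_eq_of_mem (by linarith) h]
      linarith
    · obtain ⟨u, rfl⟩ : ∃ u, t = u + 1 := ⟨t - 1, by ring⟩
      rcases eq_or_lt_of_le h with h' | h'
      · rw [← h', psi_eq_of_mem (by linarith) h1, psi_eq_of_mem (by linarith) le_rfl]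
        linarith
      · rw [psi_add_one (by linarith), psi_eq_of_mem (by linarith) h1]
        have : 1 / 2 < psi u := by
          rcases le_total u 1 with hu | hu
          · rw [psi_eq_of_mem (by linarith) hu]; linarith
          · have := half_le_psi (t := u - 1) (by linarith)
            have h2 := psi_add_one (t := u - 1) (by linarith)
            rw [sub_add_cancel] at h2
            rw [h2]; linarith
        linarith
  · intro s h0 ih t hst
    have := ih (t - 1) (by linarith)
    have h2 := psi_add_one (t := t - 1) (by linarith)
    rw [sub_add_cancel] at h2
    rw [psi_add_one h0, h2]
    linarith

theorem psi_strictMono : StrictMono psi := by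
  intro s t hst
  rcases le_total 0 s with hs | hs
  · exact psi_strictMonoOn hs (hs.trans hst.le) hst
  · have e : psi s = 1 - psi (-s) := by
      have := psi_neg (t := -s) (by linarith); rwa [neg_neg] at this
    rcases le_total 0 t with ht | ht
    · have h1 := half_le_psi (t := -s) (by linarith)
      have h2 := half_le_psi ht
      rcases eq_or_lt_of_le ht with rfl | ht
      · have := psi_strictMonoOn (a := 0) (b := -s) (by simp) (by simpa using hs) (by linarith)
        linarith
      · have := psi_strictMonoOn (a := 0) (b := t) (by simp) ht.le ht
        have h3 := half_le_psi (le_refl 0)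
        linarith
    · have e' : psi t = 1 - psi (-t) := by
        have := psi_neg (t := -t) (by linarith); rwa [neg_neg] at this
      have := psi_strictMonoOn (a := -t) (b := -s) (by simpa using ht) (by simpa using hs)
        (by linarith)
      linarith

theorem psi_mem (t : ℝ) : 0 < psi t ∧ psi t < 1 := by
  rcases le_total 0 t with h | h
  · have := half_le_psi h
    constructor <;> linarith
  · have := half_le_psi (t := -t) (by linarith)
    have h2 := psi_neg (t := -t) (by linarith)
    rw [neg_neg] at h2
    constructor <;> linarith

/-- The map `x ↦ 2 * x - 1` undoes one unit step of `psi`, so the induction runs over the distance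
of `x` from `1`. -/
theorem psi_surj_of_half_le {x : ℝ} (h : 1 / 2 ≤ x) (h1 : x < 1) : ∃ t, 0 ≤ t ∧ psi t = x := by
  have key : ∀ n : ℕ, ∀ x : ℝ, 1 / 2 ≤ x → x ≤ 1 - (1 / 2) ^ (n + 1) → ∃ t, 0 ≤ t ∧ psi t = x := by
    intro n
    induction n with
    | zero =>
      intro x h0 h1
      exact ⟨0, le_rfl, by rw [psi_eq_of_mem (by norm_num) (by norm_num)]; linarith⟩
    | succ n ih =>
      intro x h0 h1
      rcases le_total x (3 / 4) with h | h
      · exact ⟨4 * x - 2, by linarith, by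
          rw [psi_eq_of_mem (by linarith) (by linarith)]; ring⟩
      · obtain ⟨t, ht, e⟩ := ih (2 * x - 1) (by linarith) (by rw [pow_succ] at h1; linarith)
        exact ⟨t + 1, by linarith, by rw [psi_add_one ht, e]; ring⟩
  obtain ⟨n, hn⟩ := exists_pow_lt_of_lt_one (sub_pos.2 h1) (by norm_num : (1 / 2 : ℝ) < 1)
  refine key n x h ?_
  have : (1 / 2 : ℝ) ^ (n + 1) ≤ (1 / 2) ^ n :=
    pow_le_pow_of_le_one (by norm_num) (by norm_num) (Nat.le_succ n)
  linarith

theorem exists_psi_eq {x : ℝ} (h : 0 < x) (h1 : x < 1) : ∃ t, psi t = x := by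
  rcases le_total (1 / 2) x with hx | hx
  · obtain ⟨t, -, e⟩ := psi_surj_of_half_le hx h1
    exact ⟨t, e⟩
  · obtain ⟨t, ht, e⟩ := psi_surj_of_half_le (x := 1 - x) (by linarith) (by linarith)
    exact ⟨-t, by rw [psi_neg ht, e]; ring⟩

/-! ## Coordinates of a single tree -/

theorem numLeaves_pos' (T : BinaryTree Unit) : (1 : ℝ) ≤ T.numLeaves := by
  exact_mod_cast T.numLeaves_pos

theorem treeCoord_zero (T : BinaryTree Unit) : treeCoord T 0 = 0 := by
  induction T with
  | nil => rfl
  | node _ L R hL hR => rw [treeCoord, if_pos (by norm_num), mul_zero, hL]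

theorem treeCoord_one (T : BinaryTree Unit) : treeCoord T 1 = T.numLeaves := by
  induction T with
  | nil => simp [treeCoord]
  | node _ L R hL hR =>
    rw [treeCoord, if_neg (by norm_num), BinaryTree.numLeaves, Nat.cast_add]
    norm_num
    exact hR

theorem treeCoord_node_left {L R : BinaryTree Unit} {a : Unit} {x : ℝ} (h : x ≤ 1 / 2) :
    treeCoord (.node a L R) x = treeCoord L (2 * x) := by rw [treeCoord, if_pos h]

/-- Both branches agree at the midpoint, so this formula also holds on the closed half. -/
theorem treeCoord_node_right {L R : BinaryTree Unit} {a : Unit} {x : ℝ} (h : 1 / 2 ≤ x) :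
    treeCoord (.node a L R) x = L.numLeaves + treeCoord R (2 * x - 1) := by
  rcases eq_or_lt_of_le h with rfl | h
  · rw [treeCoord, if_pos le_rfl]
    norm_num [treeCoord_zero, treeCoord_one]
  · rw [treeCoord, if_neg (not_le.2 h)]

theorem treeCoord_strictMonoOn (T : BinaryTree Unit) :
    StrictMonoOn (treeCoord T) (Set.Icc 0 1) := by
  induction T with
  | nil => intro x _ y _ h; exact h
  | node a L R hL hR =>
    have key1 : ∀ x y : ℝ, 0 ≤ x → x < y → y ≤ 1 / 2 →
        treeCoord (.node a L R) x < treeCoord (.node a L R) y := by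
      intro x y h0 h h1
      rw [treeCoord_node_left (by linarith), treeCoord_node_left h1]
      exact hL ⟨by linarith, by linarith⟩ ⟨by linarith, by linarith⟩ (by linarith)
    have key2 : ∀ x y : ℝ, 1 / 2 ≤ x → x < y → y ≤ 1 →
        treeCoord (.node a L R) x < treeCoord (.node a L R) y := by
      intro x y h0 h h1
      rw [treeCoord_node_right (by linarith), treeCoord_node_right (by linarith)]
      have := hR (a := 2 * x - 1) (b := 2 * y - 1)
        ⟨by linarith, by linarith⟩ ⟨by linarith, by linarith⟩ (by linarith)
      linarith
    intro x hx y hy h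
    rcases le_total y (1 / 2) with h1 | h1
    · exact key1 x y hx.1 h h1
    · rcases le_total (1 / 2) x with h2 | h2
      · exact key2 x y h2 h hy.2
      · rcases eq_or_lt_of_le h1 with rfl | h1
        · exact key1 x _ hx.1 h le_rfl
        · rcases eq_or_lt_of_le h2 with rfl | h2
          · exact key2 _ y le_rfl h hy.2
          · exact (key1 x _ hx.1 h2 le_rfl).trans (key2 _ y le_rfl h1 hy.2)

theorem treeCoord_mem {T : BinaryTree Unit} {x : ℝ} (h0 : 0 ≤ x) (h1 : x ≤ 1) :
    0 ≤ treeCoord T x ∧ treeCoord T x ≤ T.numLeaves := by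
  have := (treeCoord_strictMonoOn T).monotoneOn
  constructor
  · rw [← treeCoord_zero T]
    exact this ⟨le_rfl, zero_le_one⟩ ⟨h0, h1⟩ h0
  · rw [← treeCoord_one T]
    exact this ⟨h0, h1⟩ ⟨zero_le_one, le_rfl⟩ h1

/-- The value at `1` is the number of leaves, which separates a leaf from a node; the two halves
then recover the two children. Every uniqueness statement about forests rests on this. -/
theorem eq_of_treeCoord_eq {T U : BinaryTree Unit}
    (h : ∀ y : ℝ, 0 ≤ y → y ≤ 1 → treeCoord T y = treeCoord U y) : T = U := by
  have leaves : ∀ {T U : BinaryTree Unit},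
      (∀ y : ℝ, 0 ≤ y → y ≤ 1 → treeCoord T y = treeCoord U y) → T.numLeaves = U.numLeaves := by
    intro T U h
    have := h 1 zero_le_one le_rfl
    rw [treeCoord_one, treeCoord_one] at this
    exact_mod_cast this
  induction T generalizing U with
  | nil =>
    cases U with
    | nil => rfl
    | node b L R =>
      have := leaves h
      have h1 := L.numLeaves_pos
      have h2 := R.numLeaves_pos
      simp only [BinaryTree.numLeaves] at this
      omega
  | node a L R hL hR =>
    cases U with
    | nil =>
      have := leaves h
      have h1 := L.numLeaves_pos
      have h2 := R.numLeaves_pos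
      simp only [BinaryTree.numLeaves] at this
      omega
    | node b L' R' =>
      have e : ∀ y : ℝ, 0 ≤ y → y ≤ 1 → treeCoord L y = treeCoord L' y := by
        intro y h0 h1
        have := h (y / 2) (by linarith) (by linarith)
        rw [treeCoord_node_left (by linarith), treeCoord_node_left (by linarith)] at this
        rwa [mul_div_cancel₀ _ (by norm_num : (2 : ℝ) ≠ 0)] at this
      have e2 := hL e
      subst e2
      rw [hR (U := R')]
      intro y h0 h1
      have := h ((y + 1) / 2) (by linarith) (by linarith)
      rw [treeCoord_node_right (by linarith), treeCoord_node_right (by linarith)] at this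
      rw [mul_div_cancel₀ _ (by norm_num : (2 : ℝ) ≠ 0), add_sub_cancel_right] at this
      linarith

/-- The increasing linear map of `[0,1]` onto the standard dyadic interval reached by a path from
the root (`false` is left, `true` is right). -/
noncomputable def pathEmbed : List Bool → ℝ → ℝ
  | [], y => y
  | false :: w, y => pathEmbed w y / 2
  | true :: w, y => (pathEmbed w y + 1) / 2

theorem pathEmbed_mem (w : List Bool) {y : ℝ} (h0 : 0 ≤ y) (h1 : y ≤ 1) :
    0 ≤ pathEmbed w y ∧ pathEmbed w y ≤ 1 := by
  induction w with
  | nil => exact ⟨h0, h1⟩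
  | cons b w ih =>
    cases b <;> simp only [pathEmbed] <;> constructor <;> linarith

theorem pathEmbed_sub (w : List Bool) : pathEmbed w 1 - pathEmbed w 0 ≤ 1 := by
  induction w with
  | nil => simp [pathEmbed]
  | cons b w ih =>
    have h1 := pathEmbed_mem w (y := 0) le_rfl zero_le_one
    have h2 := pathEmbed_mem w (y := 1) zero_le_one le_rfl
    cases b <;> simp only [pathEmbed] <;> linarith

theorem exists_leaf_path {T : BinaryTree Unit} {l : ℕ} (h : l < T.numLeaves) :
    ∃ w, ∀ y : ℝ, 0 ≤ y → y ≤ 1 → treeCoord T (pathEmbed w y) = l + y := by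
  induction T generalizing l with
  | nil =>
    have : l = 0 := by simpa [BinaryTree.numLeaves] using h
    subst this
    exact ⟨[], fun y _ _ => by simp [treeCoord, pathEmbed]⟩
  | node a L R hL hR =>
    rcases lt_or_ge l L.numLeaves with hl | hl
    · obtain ⟨w, hw⟩ := hL hl
      refine ⟨false :: w, fun y h0 h1 => ?_⟩
      have := pathEmbed_mem w h0 h1
      rw [pathEmbed, treeCoord_node_left (by linarith),
        mul_div_cancel₀ _ (by norm_num : (2 : ℝ) ≠ 0), hw y h0 h1]
    · obtain ⟨w, hw⟩ := hR (l := l - L.numLeaves)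
        (by simp only [BinaryTree.numLeaves] at h; omega)
      refine ⟨true :: w, fun y h0 h1 => ?_⟩
      have := pathEmbed_mem w h0 h1
      rw [pathEmbed, treeCoord_node_right (by linarith),
        mul_div_cancel₀ _ (by norm_num : (2 : ℝ) ≠ 0), add_sub_cancel_right, hw y h0 h1,
        Nat.cast_sub hl]
      ring

theorem exists_hasCaret {T : BinaryTree Unit} (h : T ≠ .nil) : ∃ k, HasCaret T k := by
  induction T with
  | nil => exact absurd rfl h
  | node a L R hL hR =>
    by_cases h1 : L = .nil
    · by_cases h2 : R = .nil
      · exact ⟨0, Or.inl ⟨h1, h2, rfl⟩⟩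
      · obtain ⟨k, hk⟩ := hR h2
        exact ⟨L.numLeaves + k, Or.inr (Or.inr ⟨by omega, by simpa using hk⟩)⟩
    · obtain ⟨k, hk⟩ := hL h1
      exact ⟨k, Or.inr (Or.inl hk)⟩

/-- If on some dyadic interval the subdivision `T` restricts to a copy of `B`, then the carets of
`B` are carets of `T`. -/
theorem hasCaret_of_treeCoord_pathEmbed {B : BinaryTree Unit} (hB : B ≠ .nil) {k : ℕ}
    (hk : HasCaret B k) (w : List Bool) {T : BinaryTree Unit} {C : ℕ}
    (h : ∀ y : ℝ, 0 ≤ y → y ≤ 1 → treeCoord T (pathEmbed w y) = C + treeCoord B y) :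
    HasCaret T (C + k) := by
  induction w generalizing T C with
  | nil =>
    have hC : C = 0 := by
      have := h 0 le_rfl zero_le_one
      rw [pathEmbed, treeCoord_zero, treeCoord_zero] at this
      have : (C : ℝ) = 0 := by linarith
      exact_mod_cast this
    subst hC
    have : T = B := eq_of_treeCoord_eq fun y h0 h1 => by simpa [pathEmbed] using h y h0 h1
    simpa [this] using hk
  | cons b w ih =>
    cases T with
    | nil =>
      -- A single leaf has a coordinate of slope one, which grows by at most `1` on the interval,
      -- while `B` has at least two leaves.
      exfalso
      have e1 := h 0 le_rfl zero_le_one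
      have e2 := h 1 zero_le_one le_rfl
      rw [treeCoord, treeCoord_zero] at e1
      rw [treeCoord, treeCoord_one] at e2
      have := pathEmbed_sub (b :: w)
      cases B with
      | nil => exact hB rfl
      | node _ L R =>
        have h1 := numLeaves_pos' L
        have h2 := numLeaves_pos' R
        rw [BinaryTree.numLeaves, Nat.cast_add] at e2
        linarith
    | node a L R =>
      cases b with
      | false =>
        refine Or.inr (Or.inl (ih fun y h0 h1 => ?_))
        have := pathEmbed_mem w h0 h1
        rw [← h y h0 h1, pathEmbed, treeCoord_node_left (by linarith),
          mul_div_cancel₀ _ (by norm_num : (2 : ℝ) ≠ 0)]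
      | true =>
        have key : ∀ y : ℝ, 0 ≤ y → y ≤ 1 →
            L.numLeaves + treeCoord R (pathEmbed w y) = C + treeCoord B y := by
          intro y h0 h1
          have := pathEmbed_mem w h0 h1
          rw [← h y h0 h1, pathEmbed, treeCoord_node_right (by linarith),
            mul_div_cancel₀ _ (by norm_num : (2 : ℝ) ≠ 0), add_sub_cancel_right]
        -- The copy of `B` lies inside `R`, so all leaves of `L` precede it.
        have hC : L.numLeaves ≤ C := by
          have e := key 0 le_rfl zero_le_one
          have h2 := pathEmbed_mem w (y := 0) le_rfl zero_le_one
          have h3 := treeCoord_mem (T := R) h2.1 h2.2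
          rw [treeCoord_zero] at e
          have : (L.numLeaves : ℝ) ≤ C := by linarith
          exact_mod_cast this
        refine Or.inr (Or.inr ⟨by omega, ?_⟩)
        rw [Nat.sub_add_comm hC]
        refine ih fun y h0 h1 => ?_
        have := key y h0 h1
        rw [Nat.cast_sub hC]
        linarith

end Thompson

namespace Thompson

/-! ## Pointed forests as zippers -/

/-- The total number of leaves of a list of trees. -/
def leafCount (L : List (BinaryTree Unit)) : ℕ := (L.map BinaryTree.numLeaves).sum

@[simp] theorem leafCount_nil : leafCount [] = 0 := rfl

@[simp] theorem leafCount_cons (r : BinaryTree Unit) (L : List (BinaryTree Unit)) :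
    leafCount (r :: L) = r.numLeaves + leafCount L := rfl

/-- The leaf coordinate on `[0,∞)` of the one-sided forest whose trees are the members of the list,
followed by trivial trees. -/
noncomputable def rightCoord : List (BinaryTree Unit) → ℝ → ℝ
  | [], t => t
  | r :: L, t => if t ≤ 1 then treeCoord r t else r.numLeaves + rightCoord L (t - 1)

/-- The leaf coordinate, on `[0,∞)` and counted to the left, of the one-sided forest that extends
from `0` to the left. -/
noncomputable def leftCoord : List (BinaryTree Unit) → ℝ → ℝ
  | [], t => t
  | r :: L, t =>
      if t ≤ 1 then r.numLeaves - treeCoord r (1 - t) else r.numLeaves + leftCoord L (t - 1)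

/-- The homeomorphism of `ℝ` belonging to the positive element whose top forest has the trees `ls`
to the left of the pointer (from right to left) and the trees `rs` from the pointer on. -/
noncomputable def zipCoord (ls rs : List (BinaryTree Unit)) (s : ℝ) : ℝ :=
  leafCount ls + if 0 ≤ s then rightCoord rs s else -leftCoord ls (-s)

theorem rightCoord_zero (L : List (BinaryTree Unit)) : rightCoord L 0 = 0 := by
  cases L <;> simp [rightCoord, treeCoord_zero]

theorem leftCoord_zero (L : List (BinaryTree Unit)) : leftCoord L 0 = 0 := by
  cases L <;> simp [leftCoord, treeCoord_one]

theorem rightCoord_cons_le {r : BinaryTree Unit} {L : List (BinaryTree Unit)} {t : ℝ}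
    (h : t ≤ 1) : rightCoord (r :: L) t = treeCoord r t := by rw [rightCoord, if_pos h]

theorem rightCoord_cons_ge {r : BinaryTree Unit} {L : List (BinaryTree Unit)} {t : ℝ}
    (h : 1 ≤ t) : rightCoord (r :: L) t = r.numLeaves + rightCoord L (t - 1) := by
  rcases eq_or_lt_of_le h with rfl | h
  · rw [rightCoord, if_pos le_rfl, sub_self, rightCoord_zero, treeCoord_one, add_zero]
  · rw [rightCoord, if_neg (not_le.2 h)]

theorem leftCoord_cons_le {r : BinaryTree Unit} {L : List (BinaryTree Unit)} {t : ℝ}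
    (h : t ≤ 1) : leftCoord (r :: L) t = r.numLeaves - treeCoord r (1 - t) := by
  rw [leftCoord, if_pos h]

theorem leftCoord_cons_ge {r : BinaryTree Unit} {L : List (BinaryTree Unit)} {t : ℝ}
    (h : 1 ≤ t) : leftCoord (r :: L) t = r.numLeaves + leftCoord L (t - 1) := by
  rcases eq_or_lt_of_le h with rfl | h
  · rw [leftCoord, if_pos le_rfl, sub_self, leftCoord_zero, treeCoord_zero]
    ring
  · rw [leftCoord, if_neg (not_le.2 h)]

theorem zipCoord_nonneg {ls rs : List (BinaryTree Unit)} {s : ℝ} (h : 0 ≤ s) :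
    zipCoord ls rs s = leafCount ls + rightCoord rs s := by rw [zipCoord, if_pos h]

theorem zipCoord_nonpos {ls rs : List (BinaryTree Unit)} {s : ℝ} (h : s ≤ 0) :
    zipCoord ls rs s = leafCount ls - leftCoord ls (-s) := by
  rcases eq_or_lt_of_le h with rfl | h
  · rw [zipCoord, if_pos le_rfl, neg_zero, rightCoord_zero, leftCoord_zero]
    ring
  · rw [zipCoord, if_neg (not_le.2 h)]
    ring

theorem zipCoord_zero (ls rs : List (BinaryTree Unit)) : zipCoord ls rs 0 = leafCount ls := by
  rw [zipCoord_nonneg le_rfl, rightCoord_zero, add_zero]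

/-- The offset `leafCount ls` in `zipCoord` makes this exact: moving the pointer over `r` shifts the
origin of the coordinate by the leaves of `r`. -/
theorem zipCoord_add_one (ls rs : List (BinaryTree Unit)) (r : BinaryTree Unit) (s : ℝ) :
    zipCoord ls (r :: rs) (s + 1) = zipCoord (r :: ls) rs s := by
  rcases le_total 0 s with h | h
  · rw [zipCoord_nonneg h, zipCoord_nonneg (by linarith), rightCoord_cons_ge (by linarith),
      leafCount_cons, add_sub_cancel_right]
    push_cast; ring
  · rw [zipCoord_nonpos h, leafCount_cons]
    rcases le_total (-1) s with h' | h'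
    · rw [zipCoord_nonneg (by linarith), rightCoord_cons_le (by linarith),
        leftCoord_cons_le (by linarith), show 1 - -s = s + 1 by ring]
      push_cast; ring
    · rw [zipCoord_nonpos (by linarith), leftCoord_cons_ge (by linarith),
        show -(s + 1) = -s - 1 by ring]
      push_cast; ring

/-- The conjugate of `x₁` by `psi`. -/
noncomputable def caretMap (s : ℝ) : ℝ := if s ≤ 0 then s else if s ≤ 1 then 2 * s else s + 1

/-- `caretMap` doubles `[0, 1]` onto `[0, 2]`, so the halves of the interval of the node become the
unit intervals of `a` and `b`. -/
theorem zipCoord_caretMap (ls rs : List (BinaryTree Unit)) (a b : BinaryTree Unit) (s : ℝ) :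
    zipCoord ls (a :: b :: rs) (caretMap s) = zipCoord ls (.node () a b :: rs) s := by
  rw [caretMap]
  split_ifs with h0 h1
  · rw [zipCoord_nonpos h0, zipCoord_nonpos h0]
  · rw [zipCoord_nonneg (by linarith), zipCoord_nonneg (by linarith), rightCoord_cons_le h1]
    rcases le_total s (1 / 2) with h | h
    · rw [rightCoord_cons_le (by linarith), treeCoord_node_left h]
    · rw [rightCoord_cons_ge (by linarith), rightCoord_cons_le (by linarith),
        treeCoord_node_right h]
  · rw [zipCoord_nonneg (by linarith), zipCoord_nonneg (by linarith),
      rightCoord_cons_ge (by linarith), rightCoord_cons_ge (by linarith),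
      rightCoord_cons_ge (by linarith), BinaryTree.numLeaves, add_sub_cancel_right]
    push_cast; ring

/-- The `m`-th tree of the two-way forest given by `ls` and `rs`. -/
def zipTree (ls rs : List (BinaryTree Unit)) : ℤ → BinaryTree Unit
  | Int.ofNat m => rs.getD m .nil
  | Int.negSucc m => ls.getD m .nil

theorem rightCoord_nat (L : List (BinaryTree Unit)) (m : ℕ) : ∃ e : ℕ, ∀ y : ℝ, 0 ≤ y → y ≤ 1 →
    rightCoord L (m + y) = e + treeCoord (L.getD m .nil) y := by
  induction L generalizing m with
  | nil => exact ⟨m, fun y _ _ => by simp [rightCoord, treeCoord]⟩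
  | cons r L ih =>
    cases m with
    | zero => exact ⟨0, fun y _ h1 => by simp [rightCoord_cons_le h1]⟩
    | succ m =>
      obtain ⟨e, he⟩ := ih m
      refine ⟨r.numLeaves + e, fun y h0 h1 => ?_⟩
      have hm : (0 : ℝ) ≤ m := m.cast_nonneg
      rw [rightCoord_cons_ge (by push_cast; linarith), List.getD_cons_succ,
        show ((m + 1 : ℕ) : ℝ) + y - 1 = m + y by push_cast; ring, he y h0 h1]
      push_cast; ring

/-- Here `y` runs from the left end of the unit interval while `leftCoord` counts from the right,
hence `1 - y` and the minus sign. -/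
theorem leftCoord_nat (L : List (BinaryTree Unit)) (m : ℕ) : ∃ e : ℕ, ∀ y : ℝ, 0 ≤ y → y ≤ 1 →
    leftCoord L (m + (1 - y)) = e - treeCoord (L.getD m .nil) y := by
  induction L generalizing m with
  | nil => exact ⟨m + 1, fun y _ _ => by simp [leftCoord, treeCoord]; ring⟩
  | cons r L ih =>
    cases m with
    | zero =>
      refine ⟨r.numLeaves, fun y h0 h1 => ?_⟩
      rw [leftCoord_cons_le (by push_cast; linarith)]
      simp
    | succ m =>
      obtain ⟨e, he⟩ := ih m
      refine ⟨r.numLeaves + e, fun y h0 h1 => ?_⟩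
      have hm : (0 : ℝ) ≤ m := m.cast_nonneg
      rw [leftCoord_cons_ge (by push_cast; linarith), List.getD_cons_succ,
        show ((m + 1 : ℕ) : ℝ) + (1 - y) - 1 = m + (1 - y) by push_cast; ring, he y h0 h1]
      push_cast; ring

theorem zipCoord_int (ls rs : List (BinaryTree Unit)) (m : ℤ) : ∃ e : ℤ, ∀ y : ℝ, 0 ≤ y → y ≤ 1 →
    zipCoord ls rs (m + y) = e + treeCoord (zipTree ls rs m) y := by
  cases m with
  | ofNat m =>
    obtain ⟨e, he⟩ := rightCoord_nat rs m
    refine ⟨leafCount ls + e, fun y h0 h1 => ?_⟩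
    have hm : (0 : ℝ) ≤ m := m.cast_nonneg
    rw [Int.ofNat_eq_natCast, Int.cast_natCast, zipCoord_nonneg (by linarith), he y h0 h1]
    simp only [zipTree]
    push_cast; ring
  | negSucc m =>
    obtain ⟨e, he⟩ := leftCoord_nat ls m
    refine ⟨leafCount ls - e, fun y h0 h1 => ?_⟩
    have hm : (0 : ℝ) ≤ m := m.cast_nonneg
    rw [Int.cast_negSucc, zipCoord_nonpos (by push_cast; linarith),
      show -(-((m + 1 : ℕ) : ℝ) + y) = m + (1 - y) by push_cast; ring, he y h0 h1]
    simp only [zipTree]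
    push_cast; ring

theorem zipCoord_succ_sub (ls rs : List (BinaryTree Unit)) (m : ℤ) :
    zipCoord ls rs (m + 1) = zipCoord ls rs m + (zipTree ls rs m).numLeaves := by
  obtain ⟨e, he⟩ := zipCoord_int ls rs m
  have h0 := he 0 le_rfl zero_le_one
  have h1 := he 1 zero_le_one le_rfl
  rw [treeCoord_zero, add_zero] at h0
  rw [treeCoord_one] at h1
  rw [h1, h0]
  ring

theorem exists_rightCoord_leaf (L : List (BinaryTree Unit)) (N : ℕ) : ∃ (m : ℕ) (w : List Bool),
    ∀ y : ℝ, 0 ≤ y → y ≤ 1 → rightCoord L (m + pathEmbed w y) = N + y := by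
  induction L generalizing N with
  | nil => exact ⟨N, [], fun y _ _ => by simp [rightCoord, pathEmbed]⟩
  | cons r L ih =>
    rcases lt_or_ge N r.numLeaves with h | h
    · obtain ⟨w, hw⟩ := exists_leaf_path h
      refine ⟨0, w, fun y h0 h1 => ?_⟩
      have := pathEmbed_mem w h0 h1
      rw [Nat.cast_zero, zero_add, rightCoord_cons_le this.2, hw y h0 h1]
    · obtain ⟨m, w, hw⟩ := ih (N - r.numLeaves)
      refine ⟨m + 1, w, fun y h0 h1 => ?_⟩
      have := pathEmbed_mem w h0 h1
      have hm : (0 : ℝ) ≤ m := m.cast_nonneg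
      rw [rightCoord_cons_ge (by push_cast; linarith),
        show ((m + 1 : ℕ) : ℝ) + pathEmbed w y - 1 = m + pathEmbed w y by push_cast; ring,
        hw y h0 h1, Nat.cast_sub h]
      ring

theorem exists_leftCoord_leaf (L : List (BinaryTree Unit)) (N : ℕ) : ∃ (m : ℕ) (w : List Bool),
    ∀ y : ℝ, 0 ≤ y → y ≤ 1 → leftCoord L (m + (1 - pathEmbed w y)) = N + (1 - y) := by
  induction L generalizing N with
  | nil => exact ⟨N, [], fun y _ _ => by simp [leftCoord, pathEmbed]⟩
  | cons r L ih =>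
    rcases lt_or_ge N r.numLeaves with h | h
    · obtain ⟨w, hw⟩ := exists_leaf_path (T := r) (l := r.numLeaves - 1 - N) (by omega)
      refine ⟨0, w, fun y h0 h1 => ?_⟩
      have := pathEmbed_mem w h0 h1
      rw [Nat.cast_zero, zero_add, leftCoord_cons_le (by linarith), sub_sub_cancel, hw y h0 h1,
        Nat.cast_sub (by omega), Nat.cast_sub (by omega)]
      push_cast; ring
    · obtain ⟨m, w, hw⟩ := ih (N - r.numLeaves)
      refine ⟨m + 1, w, fun y h0 h1 => ?_⟩
      have := pathEmbed_mem w h0 h1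
      have hm : (0 : ℝ) ≤ m := m.cast_nonneg
      rw [leftCoord_cons_ge (by push_cast; linarith),
        show ((m + 1 : ℕ) : ℝ) + (1 - pathEmbed w y) - 1 = m + (1 - pathEmbed w y) by
          push_cast; ring,
        hw y h0 h1, Nat.cast_sub h]
      ring

/-- The preimage of a unit interval is a dyadic interval inside a single tree of the zipper; through
it a bottom tree can be pulled back to the top forest. -/
theorem exists_zipCoord_leaf (ls rs : List (BinaryTree Unit)) (i : ℤ) :
    ∃ (m : ℤ) (w : List Bool), ∀ y : ℝ, 0 ≤ y → y ≤ 1 →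
      zipCoord ls rs (m + pathEmbed w y) = i + y := by
  rcases le_or_gt (leafCount ls : ℤ) i with h | h
  · obtain ⟨m, w, hw⟩ := exists_rightCoord_leaf rs (i - leafCount ls).toNat
    refine ⟨m, w, fun y h0 h1 => ?_⟩
    have := pathEmbed_mem w h0 h1
    have hm : (0 : ℝ) ≤ m := m.cast_nonneg
    have e : (((i - leafCount ls).toNat : ℕ) : ℝ) = i - leafCount ls := by
      have : (((i - leafCount ls).toNat : ℕ) : ℤ) = i - leafCount ls :=
        Int.toNat_of_nonneg (by omega)
      exact_mod_cast this
    rw [Int.cast_natCast, zipCoord_nonneg (by linarith), hw y h0 h1, e]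
    ring
  · obtain ⟨m, w, hw⟩ := exists_leftCoord_leaf ls (leafCount ls - i - 1).toNat
    refine ⟨-m - 1, w, fun y h0 h1 => ?_⟩
    have := pathEmbed_mem w h0 h1
    have hm : (0 : ℝ) ≤ m := m.cast_nonneg
    have e : (((leafCount ls - i - 1).toNat : ℕ) : ℝ) = leafCount ls - i - 1 := by
      have : (((leafCount ls - i - 1).toNat : ℕ) : ℤ) = leafCount ls - i - 1 :=
        Int.toNat_of_nonneg (by omega)
      exact_mod_cast this
    rw [zipCoord_nonpos (by push_cast; linarith),
      show -(((-m - 1 : ℤ) : ℝ) + pathEmbed w y) = m + (1 - pathEmbed w y) by push_cast; ring,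
      hw y h0 h1, e]
    ring

/-! ### The forest coordinate -/

theorem Forest.firstLeaf_zero (T : Forest) : T.firstLeaf 0 = 0 := by simp [Forest.firstLeaf]

theorem Forest.firstLeaf_add_one (T : Forest) (i : ℤ) :
    T.firstLeaf (i + 1) = T.firstLeaf i + (T.tree i).numLeaves := by
  rw [Forest.firstLeaf, Forest.firstLeaf]
  rcases le_or_gt 0 i with h | h
  · rw [Finset.Ico_eq_empty_of_le (show 0 ≤ i + 1 by omega), Finset.Ico_eq_empty_of_le h,
      ← Finset.insert_Ico_right_eq_Ico_add_one h, Finset.sum_insert (by simp)]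
    ring
  · rw [Finset.Ico_eq_empty_of_le (show i + 1 ≤ 0 by omega), Finset.Ico_eq_empty_of_le h.le,
      ← Finset.insert_Ico_add_one_left_eq_Ico h, Finset.sum_insert (by simp)]
    simp

theorem Forest.firstLeaf_mono (T : Forest) : Monotone T.firstLeaf :=
  monotone_int_of_le_succ fun i => by rw [T.firstLeaf_add_one]; omega

theorem Forest.coord_int_add (T : Forest) (m : ℤ) {y : ℝ} (h0 : 0 ≤ y) (h1 : y ≤ 1) :
    T.coord (m + y) = T.firstLeaf m + treeCoord (T.tree m) y := by
  rcases eq_or_lt_of_le h1 with rfl | h1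
  · rw [Forest.coord, treeCoord_one, ← Int.cast_one (R := ℝ), ← Int.cast_add, Int.floor_intCast,
      Int.fract_intCast, treeCoord_zero, T.firstLeaf_add_one]
    push_cast; ring
  · have hf : ⌊(m : ℝ) + y⌋ = m := by
      rw [Int.floor_eq_iff]; constructor <;> linarith
    rw [Forest.coord, Int.fract, hf, add_sub_cancel_left]

theorem Forest.coord_int (T : Forest) (m : ℤ) : T.coord m = T.firstLeaf m := by
  have := T.coord_int_add m (y := 0) le_rfl zero_le_one
  rwa [add_zero, treeCoord_zero, add_zero] at this

theorem Forest.coord_zero (T : Forest) : T.coord 0 = 0 := by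
  have := T.coord_int 0
  rwa [Int.cast_zero, T.firstLeaf_zero, Int.cast_zero] at this

theorem exists_int_add (s : ℝ) : ∃ (m : ℤ) (y : ℝ), 0 ≤ y ∧ y ≤ 1 ∧ s = m + y :=
  ⟨⌊s⌋, Int.fract s, Int.fract_nonneg s, (Int.fract_lt_one s).le, (Int.floor_add_fract s).symm⟩

theorem Forest.firstLeaf_of_trivial {T : Forest} (h : ∀ i, T.tree i = .nil) (i : ℤ) :
    T.firstLeaf i = i := by
  induction i using Int.induction_on with
  | zero => exact T.firstLeaf_zero
  | succ i ih => rw [T.firstLeaf_add_one, ih, h]; simp [BinaryTree.numLeaves]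
  | pred i ih =>
    have := T.firstLeaf_add_one (-i - 1)
    rw [sub_add_cancel, ih, h] at this
    simp only [BinaryTree.numLeaves] at this
    omega

theorem Forest.coord_of_trivial {T : Forest} (h : ∀ i, T.tree i = .nil) (s : ℝ) :
    T.coord s = s := by
  rw [Forest.coord, Forest.firstLeaf_of_trivial h, h, treeCoord, Int.floor_add_fract]

/-- Two numberings of the same leaves: `firstLeaf` starts at the pointer, `zipCoord` at the far left
end of `ls`. -/
theorem firstLeaf_of_zipTree {T : Forest} {ls rs : List (BinaryTree Unit)}
    (h : ∀ i, T.tree i = zipTree ls rs i) (i : ℤ) :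
    (T.firstLeaf i : ℝ) + leafCount ls = zipCoord ls rs i := by
  induction i using Int.induction_on with
  | zero => rw [T.firstLeaf_zero, Int.cast_zero, zipCoord_zero, zero_add]
  | succ i ih =>
    rw [T.firstLeaf_add_one, h]
    push_cast at ih ⊢
    have := zipCoord_succ_sub ls rs i
    push_cast at this
    rw [this, ← ih]
    ring
  | pred i ih =>
    have h1 := T.firstLeaf_add_one (-i - 1)
    have h2 := zipCoord_succ_sub ls rs (-i - 1)
    rw [sub_add_cancel, h] at h1
    rw [h1] at ih
    push_cast at ih h2 ⊢
    rw [sub_add_cancel, ← ih] at h2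
    linarith

theorem coord_of_zipTree {T : Forest} {ls rs : List (BinaryTree Unit)}
    (h : ∀ i, T.tree i = zipTree ls rs i) (s : ℝ) :
    T.coord s + leafCount ls = zipCoord ls rs s := by
  obtain ⟨m, y, h0, h1, rfl⟩ := exists_int_add s
  obtain ⟨e, he⟩ := zipCoord_int ls rs m
  have e0 := he 0 le_rfl zero_le_one
  rw [add_zero, treeCoord_zero, add_zero, ← firstLeaf_of_zipTree h] at e0
  rw [T.coord_int_add m h0 h1, he y h0 h1, h, ← e0]
  ring

/-- A forest whose coordinate is, up to a shift, that of a zipper has the trees of the zipper. -/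
theorem tree_eq_zipTree {T : Forest} {ls rs : List (BinaryTree Unit)} {c : ℝ}
    (h : ∀ s, T.coord s + c = zipCoord ls rs s) (m : ℤ) : T.tree m = zipTree ls rs m := by
  obtain ⟨e, he⟩ := zipCoord_int ls rs m
  refine eq_of_treeCoord_eq fun y h0 h1 => ?_
  have e0 := h (m + 0)
  have ey := h (m + y)
  rw [T.coord_int_add m le_rfl zero_le_one, he 0 le_rfl zero_le_one, treeCoord_zero,
    treeCoord_zero] at e0
  rw [T.coord_int_add m h0 h1, he y h0 h1] at ey
  linarith

theorem zipTree_eq_of_zipCoord_eq {ls rs ls' rs' : List (BinaryTree Unit)}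
    (h : ∀ s, zipCoord ls rs s = zipCoord ls' rs' s) (m : ℤ) :
    zipTree ls rs m = zipTree ls' rs' m := by
  obtain ⟨e, he⟩ := zipCoord_int ls rs m
  obtain ⟨e', he'⟩ := zipCoord_int ls' rs' m
  refine eq_of_treeCoord_eq fun y h0 h1 => ?_
  have e0 := h (m + 0)
  have ey := h (m + y)
  rw [he 0 le_rfl zero_le_one, he' 0 le_rfl zero_le_one, treeCoord_zero, treeCoord_zero] at e0
  rw [he y h0 h1, he' y h0 h1] at ey
  linarith

theorem zipTree_ne_nil_finite (ls rs : List (BinaryTree Unit)) :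
    {i | zipTree ls rs i ≠ .nil}.Finite := by
  refine (Set.finite_Icc (-(ls.length : ℤ)) rs.length).subset fun i hi => ?_
  by_contra hc
  apply hi
  rw [Set.mem_Icc, not_and_or] at hc
  cases i with
  | ofNat m =>
    simp only [zipTree]
    exact List.getD_eq_default _ _ (by simp only [Int.ofNat_eq_natCast] at hc; omega)
  | negSucc m =>
    simp only [zipTree]
    exact List.getD_eq_default _ _ (by omega)

/-- The two-way forest given by a zipper. -/
def zipForest (ls rs : List (BinaryTree Unit)) : Forest :=
  ⟨zipTree ls rs, zipTree_ne_nil_finite ls rs⟩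

/-! ### Uniqueness and normalization of zippers. -/

theorem eq_of_getD_eq_of_leafCount_eq {L L' : List (BinaryTree Unit)}
    (h : ∀ m, L.getD m .nil = L'.getD m .nil) (hl : leafCount L = leafCount L') : L = L' := by
  induction L generalizing L' with
  | nil =>
    cases L' with
    | nil => rfl
    | cons r L' =>
      have := r.numLeaves_pos
      simp at hl
      omega
  | cons r L ih =>
    cases L' with
    | nil =>
      have := r.numLeaves_pos
      simp at hl
      omega
    | cons r' L' =>
      have h0 : r = r' := h 0
      subst h0
      rw [ih (L' := L') (fun m => h (m + 1)) (by simpa using hl)]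

/-- The value at `0` is the leaf count of the left list, which fixes its trailing trivial trees.
Those of the right list leave no trace in the map and are fixed by the total. -/
theorem eq_of_zipCoord_eq {ls rs ls' rs' : List (BinaryTree Unit)}
    (h : ∀ s, zipCoord ls rs s = zipCoord ls' rs' s)
    (hl : leafCount ls + leafCount rs = leafCount ls' + leafCount rs') : ls = ls' ∧ rs = rs' := by
  have h0 := h 0
  rw [zipCoord_zero, zipCoord_zero] at h0
  have h0 : leafCount ls = leafCount ls' := by exact_mod_cast h0
  have ht := zipTree_eq_of_zipCoord_eq h
  exact ⟨eq_of_getD_eq_of_leafCount_eq (fun m => ht (Int.negSucc m)) h0,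
    eq_of_getD_eq_of_leafCount_eq (fun m => ht (Int.ofNat m)) (by omega)⟩

/-- If all nontrivial trees lie in the first `M` leaves, then the list may be extended or shortened
by trivial trees so that there are exactly `M` leaves. -/
theorem exists_leafCount_eq (L : List (BinaryTree Unit)) {M : ℕ}
    (h : ∀ i : ℕ, L.getD i .nil ≠ .nil → rightCoord L (i + 1) ≤ M) :
    ∃ L', leafCount L' = M ∧ ∀ i, L'.getD i .nil = L.getD i .nil := by
  have trivial_case : ∀ M : ℕ, leafCount (List.replicate M .nil) = M := fun M => by
    simp [leafCount, BinaryTree.numLeaves]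
  have getD_replicate : ∀ M i : ℕ,
      (List.replicate M (.nil : BinaryTree Unit)).getD i .nil = .nil := fun M i => by
    rw [List.getD_eq_getElem?_getD, List.getElem?_replicate]
    split_ifs <;> rfl
  induction L generalizing M with
  | nil =>
    exact ⟨List.replicate M .nil, trivial_case M, fun i => by rw [getD_replicate]; rfl⟩
  | cons r L ih =>
    by_cases hn : ∀ i, (r :: L).getD i .nil = .nil
    · refine ⟨List.replicate M .nil, trivial_case M, fun i => ?_⟩
      rw [hn, getD_replicate]
    · push Not at hn
      obtain ⟨i, hi⟩ := hn
      have hpos : ∀ i : ℕ, 0 ≤ rightCoord L i := by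
        intro i
        obtain ⟨e, he⟩ := rightCoord_nat L i
        have := he 0 le_rfl zero_le_one
        rw [add_zero, treeCoord_zero, add_zero] at this
        rw [this]; exact e.cast_nonneg
      -- Some tree from `r` on is nontrivial and ends within the first `M` leaves, so `r` fits as
      -- well.
      have hr : r.numLeaves ≤ M := by
        have h1 := h i hi
        have h2 : (0 : ℝ) ≤ i := i.cast_nonneg
        rw [rightCoord_cons_ge (by linarith), add_sub_cancel_right] at h1
        have := hpos i
        have : (r.numLeaves : ℝ) ≤ M := by linarith
        exact_mod_cast this
      obtain ⟨L', h1, h2⟩ := ih (M := M - r.numLeaves) (fun j hj => by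
        have h3 := h (j + 1) (by simpa using hj)
        have h2 : (0 : ℝ) ≤ j := j.cast_nonneg
        rw [rightCoord_cons_ge (by push_cast; linarith), add_sub_cancel_right] at h3
        rw [Nat.cast_sub hr]
        push_cast at h3
        linarith)
      refine ⟨r :: L', by rw [leafCount_cons, h1]; omega, fun i => ?_⟩
      cases i with
      | zero => rfl
      | succ i => simpa using h2 i

theorem rightCoord_eq_of_getD_eq {L L' : List (BinaryTree Unit)}
    (h : ∀ i, L'.getD i .nil = L.getD i .nil) {t : ℝ} (ht : 0 ≤ t) :
    rightCoord L' t = rightCoord L t := by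
  have key : ∀ m : ℕ, rightCoord L' m = rightCoord L m := by
    intro m
    induction m with
    | zero => rw [Nat.cast_zero, rightCoord_zero, rightCoord_zero]
    | succ m ih =>
      obtain ⟨e, he⟩ := rightCoord_nat L m
      obtain ⟨e', he'⟩ := rightCoord_nat L' m
      have h0 := he 0 le_rfl zero_le_one
      have h0' := he' 0 le_rfl zero_le_one
      rw [add_zero, treeCoord_zero, add_zero] at h0 h0'
      have h1 := he 1 zero_le_one le_rfl
      have h1' := he' 1 zero_le_one le_rfl
      push_cast
      rw [h1, h1', ← h0, ← h0', ih, h]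
  obtain ⟨e, he⟩ := rightCoord_nat L ⌊t⌋₊
  obtain ⟨e', he'⟩ := rightCoord_nat L' ⌊t⌋₊
  have h0 := he 0 le_rfl zero_le_one
  have h0' := he' 0 le_rfl zero_le_one
  rw [add_zero, treeCoord_zero, add_zero] at h0 h0'
  have y0 : 0 ≤ t - ⌊t⌋₊ := by linarith [Nat.floor_le ht]
  have y1 : t - ⌊t⌋₊ ≤ 1 := by linarith [Nat.lt_floor_add_one t]
  have h1 := he _ y0 y1
  have h1' := he' _ y0 y1
  rw [add_sub_cancel] at h1 h1'
  rw [h1, h1', ← h0, ← h0', key, h]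

theorem zipCoord_eq_of_getD_eq {ls L L' : List (BinaryTree Unit)}
    (h : ∀ i, L'.getD i .nil = L.getD i .nil) (s : ℝ) :
    zipCoord ls L' s = zipCoord ls L s := by
  rcases le_total 0 s with hs | hs
  · rw [zipCoord_nonneg hs, zipCoord_nonneg hs, rightCoord_eq_of_getD_eq h hs]
  · rw [zipCoord_nonpos hs, zipCoord_nonpos hs]

end Thompson

namespace Thompson

/-! ## Elements of `F` realizing zippers -/

/-- The conjugate of `f` by `psi` is the map `zipCoord ls rs`. -/
def Realizes (ls rs : List (BinaryTree Unit)) (f : F) : Prop :=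
  ∀ (s : ℝ) (x : unitInterval), (x : ℝ) = psi s →
    ((f : unitInterval ≃o unitInterval) x : ℝ) = psi (zipCoord ls rs s)

theorem Realizes.congr {ls rs ls' rs' : List (BinaryTree Unit)} {f : F} (hf : Realizes ls rs f)
    (h : ∀ s, zipCoord ls' rs' s = zipCoord ls rs s) : Realizes ls' rs' f := fun s x hx => by
  rw [h, hf s x hx]

theorem exists_coe_eq_psi (s : ℝ) : ∃ x : unitInterval, (x : ℝ) = psi s :=
  ⟨⟨psi s, (psi_mem s).1.le, (psi_mem s).2.le⟩, rfl⟩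

theorem orderIso_zero (f : unitInterval ≃o unitInterval) : f 0 = 0 := f.map_bot

theorem orderIso_one (f : unitInterval ≃o unitInterval) : f 1 = 1 := f.map_top

theorem eq_zero_or_one_or_psi (x : unitInterval) : x = 0 ∨ x = 1 ∨ ∃ s, (x : ℝ) = psi s := by
  rcases eq_or_lt_of_le x.2.1 with h | h
  · exact Or.inl (Subtype.ext h.symm)
  · rcases eq_or_lt_of_le x.2.2 with h1 | h1
    · exact Or.inr (Or.inl (Subtype.ext h1))
    · obtain ⟨s, hs⟩ := exists_psi_eq h h1
      exact Or.inr (Or.inr ⟨s, hs.symm⟩)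

/-- `psi` covers the open interval, and an order isomorphism fixes both endpoints. -/
theorem Realizes.unique {ls rs : List (BinaryTree Unit)} {f g : F} (hf : Realizes ls rs f)
    (hg : Realizes ls rs g) : f = g := by
  apply Subtype.ext
  apply RelIso.ext
  intro x
  rcases eq_zero_or_one_or_psi x with rfl | rfl | ⟨s, hs⟩
  · exact (orderIso_zero f.1).trans (orderIso_zero g.1).symm
  · exact (orderIso_one f.1).trans (orderIso_one g.1).symm
  · exact Subtype.ext ((hf s x hs).trans (hg s x hs).symm)

theorem Realizes.zipCoord_eq {ls rs ls' rs' : List (BinaryTree Unit)} {f : F}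
    (h : Realizes ls rs f) (h' : Realizes ls' rs' f) (s : ℝ) :
    zipCoord ls rs s = zipCoord ls' rs' s := by
  obtain ⟨x, hx⟩ := exists_coe_eq_psi s
  exact psi_strictMono.injective ((h s x hx).symm.trans (h' s x hx))

theorem x0Fun_psi (s : ℝ) : x0Fun (psi s) = psi (s + 1) := by
  rcases le_total s (-1) with h | h
  · have h1 := psi_sub_one (t := s + 1) (by linarith)
    rw [add_sub_cancel_right] at h1
    have h2 := psi_strictMono.monotone h
    rw [psi_eq_of_mem le_rfl (by norm_num)] at h2
    rw [x0Fun, if_pos (by linarith)]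
    linarith
  · rcases le_total s 0 with h' | h'
    · rw [psi_eq_of_mem (by linarith) (by linarith), psi_eq_of_mem (by linarith) (by linarith),
        x0Fun]
      split_ifs <;> linarith
    · have h2 := psi_strictMono.monotone h'
      rw [psi_eq_of_mem (by norm_num) (by norm_num)] at h2
      rw [psi_add_one h', x0Fun]
      split_ifs <;> linarith

theorem x1Fun_psi (s : ℝ) : x1Fun (psi s) = psi (caretMap s) := by
  rw [caretMap]
  split_ifs with h0 h1
  · have h2 := psi_strictMono.monotone h0
    rw [psi_eq_of_mem (t := 0) (by norm_num) (by norm_num)] at h2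
    rw [x1Fun, if_pos (by linarith)]
  · rcases le_total s (1 / 2) with h | h
    · rw [psi_eq_of_mem (by linarith) (by linarith), psi_eq_of_mem (by linarith) (by linarith),
        x1Fun]
      split_ifs <;> linarith
    · have h2 := psi_add_one (t := 2 * s - 1) (by linarith)
      rw [sub_add_cancel] at h2
      rw [h2, psi_eq_of_mem (by linarith) (by linarith), psi_eq_of_mem (by linarith) (by linarith),
        x1Fun]
      split_ifs <;> linarith
  · have h2 := psi_strictMono.monotone (not_le.1 h1).le
    rw [psi_eq_of_mem (by norm_num) (by norm_num)] at h2
    rw [psi_add_one (by linarith), x1Fun]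
    split_ifs <;> linarith

theorem x0_apply (x : unitInterval) :
    (((x0 : F) : unitInterval ≃o unitInterval) x : ℝ) = x0Fun x := rfl

theorem x1_apply (x : unitInterval) :
    (((x1 : F) : unitInterval ≃o unitInterval) x : ℝ) = x1Fun x := rfl

theorem mul_coe_apply (f g : F) (x : unitInterval) :
    ((f * g : F) : unitInterval ≃o unitInterval) x =
      (f : unitInterval ≃o unitInterval) ((g : unitInterval ≃o unitInterval) x) := rfl

/-- In the `psi` coordinate `x0` is translation by one, so it moves the top pointer one tree to the
right. -/
theorem realizes_mul_x0_iff {ls rs : List (BinaryTree Unit)} {r : BinaryTree Unit} {f : F} :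
    Realizes (r :: ls) rs (f * x0) ↔ Realizes ls (r :: rs) f := by
  constructor
  · intro h s x hx
    obtain ⟨y, hy⟩ := exists_coe_eq_psi (s - 1)
    have h1 := h (s - 1) y hy
    have : ((x0 : F) : unitInterval ≃o unitInterval) y = x := Subtype.ext <| by
      rw [x0_apply, hy, x0Fun_psi, sub_add_cancel, hx]
    rw [mul_coe_apply, this, ← zipCoord_add_one, sub_add_cancel] at h1
    exact h1
  · intro h s x hx
    rw [mul_coe_apply, h (s + 1) _ (by rw [x0_apply, hx, x0Fun_psi]), zipCoord_add_one]

/-- `x1` puts a caret over the tree at the pointer and its right neighbour. -/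
theorem Realizes.mul_x1 {ls rs : List (BinaryTree Unit)} {a b : BinaryTree Unit} {f : F}
    (h : Realizes ls (a :: b :: rs) f) : Realizes ls (.node () a b :: rs) (f * x1) := by
  intro s x hx
  rw [mul_coe_apply, h (caretMap s) _ (by rw [x1_apply, hx, x1Fun_psi]), zipCoord_caretMap]

theorem zipCoord_append_nil (ls rs : List (BinaryTree Unit)) (s : ℝ) :
    zipCoord ls (rs ++ [.nil]) s = zipCoord ls rs s := by
  refine zipCoord_eq_of_getD_eq (fun i => ?_) s
  rcases lt_or_ge i rs.length with h | h
  · exact List.getD_append _ _ _ _ h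
  · rw [List.getD_append_right _ _ _ _ h, List.getD_eq_default rs _ h]
    cases i - rs.length <;> rfl

/-- Every zipper is built from the identity by the pointer moves `x0`, `x0⁻¹` and the caret `x1`. -/
theorem exists_realizes (ls rs : List (BinaryTree Unit)) : ∃ f, Realizes ls rs f := by
  have single : ∀ (r : BinaryTree Unit) (ls : List (BinaryTree Unit)),
      (∃ f, Realizes ls [] f) → ∃ f, Realizes ls [r] f := by
    intro r
    induction r with
    | nil =>
      rintro ls ⟨f, hf⟩
      exact ⟨f, hf.congr (zipCoord_append_nil ls [])⟩
    | node u a b ha hb =>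
      intro ls h
      -- Grow `a` at the pointer, step right, grow `b`, step back, and join the two.
      obtain ⟨f, hf⟩ := ha ls h
      obtain ⟨g, hg⟩ := hb (a :: ls) ⟨f * x0, realizes_mul_x0_iff.2 hf⟩
      have : Realizes ls [a, b] (g * x0⁻¹) := by
        rw [← realizes_mul_x0_iff, inv_mul_cancel_right]
        exact hg
      exact ⟨_, this.mul_x1⟩
  have right : ∀ (rs ls : List (BinaryTree Unit)),
      (∃ f, Realizes ls [] f) → ∃ f, Realizes ls rs f := by
    intro rs
    induction rs with
    | nil => exact fun ls h => h
    | cons r rs ih =>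
      intro ls h
      obtain ⟨f, hf⟩ := single r ls h
      obtain ⟨g, hg⟩ := ih (r :: ls) ⟨f * x0, realizes_mul_x0_iff.2 hf⟩
      refine ⟨g * x0⁻¹, ?_⟩
      rw [← realizes_mul_x0_iff, inv_mul_cancel_right]
      exact hg
  refine right rs ls ?_
  induction ls with
  | nil =>
    refine ⟨1, fun s x hx => ?_⟩
    have : zipCoord [] [] s = s := by
      rcases le_total 0 s with h | h
      · rw [zipCoord_nonneg h, rightCoord]; simp
      · rw [zipCoord_nonpos h, leftCoord]; simp
    rw [this, ← hx]
    rfl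
  | cons r ls ih =>
    obtain ⟨f, hf⟩ := single r ls ih
    exact ⟨f * x0, realizes_mul_x0_iff.2 hf⟩

/-- An element realizing the split zipper exists, and its product with `x1` must be `f` by
uniqueness. -/
theorem Realizes.mul_x1_inv {ls rs : List (BinaryTree Unit)} {a b : BinaryTree Unit} {f : F}
    (h : Realizes ls (.node () a b :: rs) f) : Realizes ls (a :: b :: rs) (f * x1⁻¹) := by
  obtain ⟨g, hg⟩ := exists_realizes ls (a :: b :: rs)
  have := hg.mul_x1.unique h
  rw [← this, mul_inv_cancel_right]
  exact hg

/-! ## Forest diagrams of realized elements -/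

theorem ForestDiagram.represents_iff {D : ForestDiagram} {ls rs : List (BinaryTree Unit)} {f : F}
    (hf : Realizes ls rs f) : D.Represents f ↔
      ∀ s, D.bottom.coord (zipCoord ls rs s) = D.top.coord s + D.shift := by
  constructor
  · intro h s
    obtain ⟨x, hx⟩ := exists_coe_eq_psi s
    obtain ⟨t, ht, e⟩ := h x s hx
    rw [hf s x hx] at ht
    rw [psi_strictMono.injective ht, e]
  · intro h x s hx
    exact ⟨_, hf s x hx, h s⟩

/-- The bottom forest of a reduced diagram of a realized element is trivial. -/
theorem ForestDiagram.bottom_trivial {D : ForestDiagram} {ls rs : List (BinaryTree Unit)} {f : F}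
    (hf : Realizes ls rs f) (hD : D.Represents f) (hr : D.IsReduced) (i : ℤ) :
    D.bottom.tree i = .nil := by
  by_contra hne
  rw [ForestDiagram.represents_iff hf] at hD
  obtain ⟨k, hk⟩ := exists_hasCaret hne
  obtain ⟨m, w, hw⟩ := exists_zipCoord_leaf ls rs i
  -- On the dyadic interval that is mapped onto `[i, i+1]`, the top subdivision is a copy of bottom
  -- tree `i`. Any caret of that tree is then opposed by a caret of the copy.
  have key : ∀ y : ℝ, 0 ≤ y → y ≤ 1 → D.bottom.firstLeaf i + treeCoord (D.bottom.tree i) y =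
      D.top.firstLeaf m + treeCoord (D.top.tree m) (pathEmbed w y) + D.shift := by
    intro y h0 h1
    have h2 := pathEmbed_mem w h0 h1
    rw [← D.bottom.coord_int_add i h0 h1, ← D.top.coord_int_add m h2.1 h2.2, ← hw y h0 h1, hD]
  -- The number of leaves of top tree `m` that precede the copy.
  set C : ℤ := D.bottom.firstLeaf i - D.top.firstLeaf m - D.shift with hC
  have hC0 : 0 ≤ C := by
    have e := key 0 le_rfl zero_le_one
    have h2 := pathEmbed_mem w (y := 0) le_rfl zero_le_one
    have h3 := (treeCoord_mem (T := D.top.tree m) h2.1 h2.2).1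
    rw [treeCoord_zero] at e
    have : (0 : ℝ) ≤ C := by rw [hC]; push_cast; linarith
    exact_mod_cast this
  obtain ⟨c, hc⟩ := Int.eq_ofNat_of_zero_le hC0
  have hcar := hasCaret_of_treeCoord_pathEmbed hne hk w (T := D.top.tree m) (C := c) (by
    intro y h0 h1
    have e := key y h0 h1
    have : (c : ℝ) = D.bottom.firstLeaf i - D.top.firstLeaf m - D.shift := by
      have : ((c : ℤ) : ℝ) = (C : ℝ) := by rw [hc]
      rw [hC] at this
      push_cast at this
      exact this
    linarith)
  refine hr (D.top.firstLeaf m + (c + k : ℕ)) ⟨⟨m, _, hcar, rfl⟩, i, k, hk, ?_⟩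
  push_cast
  omega

theorem ForestDiagram.shift_eq {D : ForestDiagram} {ls rs : List (BinaryTree Unit)} {f : F}
    (hf : Realizes ls rs f) (hD : D.Represents f) (hr : D.IsReduced) :
    D.shift = leafCount ls := by
  have hb := ForestDiagram.bottom_trivial hf hD hr
  rw [ForestDiagram.represents_iff hf] at hD
  have := hD 0
  rw [Forest.coord_of_trivial hb, zipCoord_zero, D.top.coord_zero, zero_add] at this
  exact_mod_cast this.symm

theorem ForestDiagram.top_tree {D : ForestDiagram} {ls rs : List (BinaryTree Unit)} {f : F}
    (hf : Realizes ls rs f) (hD : D.Represents f) (hr : D.IsReduced) (i : ℤ) :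
    D.top.tree i = zipTree ls rs i := by
  have hb := ForestDiagram.bottom_trivial hf hD hr
  rw [ForestDiagram.represents_iff hf] at hD
  refine tree_eq_zipTree (c := D.shift) (fun s => ?_) i
  rw [← hD s, Forest.coord_of_trivial hb]

/-- The reduced forest diagram of the element realizing a zipper. -/
def zipDiagram (ls rs : List (BinaryTree Unit)) : ForestDiagram :=
  ⟨zipForest ls rs, zipForest [] [], leafCount ls⟩

theorem zipTree_nil_nil (i : ℤ) : zipTree [] [] i = .nil := by cases i <;> rfl

theorem zipDiagram_represents {ls rs : List (BinaryTree Unit)} {f : F} (hf : Realizes ls rs f) :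
    (zipDiagram ls rs).Represents f := by
  rw [ForestDiagram.represents_iff hf]
  intro s
  rw [Forest.coord_of_trivial (T := (zipDiagram ls rs).bottom) zipTree_nil_nil,
    ← coord_of_zipTree (T := (zipDiagram ls rs).top) (fun _ => rfl)]
  simp [zipDiagram]

theorem zipDiagram_isReduced (ls rs : List (BinaryTree Unit)) : (zipDiagram ls rs).IsReduced := by
  rintro j ⟨-, i, k, h, -⟩
  rw [show (zipDiagram ls rs).bottom.tree i = .nil from zipTree_nil_nil i] at h
  exact h

theorem height_zipTree_le {ls rs : List (BinaryTree Unit)} {k : ℕ}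
    (hl : ∀ T ∈ ls, T.height ≤ k) (hr : ∀ T ∈ rs, T.height ≤ k) (i : ℤ) :
    (zipTree ls rs i).height ≤ k := by
  have key : ∀ (L : List (BinaryTree Unit)), (∀ T ∈ L, T.height ≤ k) →
      ∀ m : ℕ, (L.getD m .nil).height ≤ k := by
    intro L hL m
    rcases lt_or_ge m L.length with h | h
    · rw [List.getD_eq_getElem _ _ h]
      exact hL _ (List.getElem_mem h)
    · rw [List.getD_eq_default _ _ h]
      exact Nat.zero_le k
  cases i with
  | ofNat m => exact key rs hr m
  | negSucc m => exact key ls hl m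

theorem height_le_of_getD {L : List (BinaryTree Unit)} {k : ℕ}
    (h : ∀ m : ℕ, (L.getD m .nil).height ≤ k) : ∀ T ∈ L, T.height ≤ k := by
  intro T hT
  obtain ⟨m, hm, rfl⟩ := List.getElem_of_mem hT
  have := h m
  rwa [List.getD_eq_getElem _ _ hm] at this

/-! ### Support and width. -/

theorem rightCoord_length (L : List (BinaryTree Unit)) : rightCoord L L.length = leafCount L := by
  induction L with
  | nil => simp [rightCoord]
  | cons r L ih =>
    have : (0 : ℝ) ≤ L.length := Nat.cast_nonneg _
    rw [rightCoord_cons_ge (by rw [List.length_cons]; push_cast; linarith), List.length_cons,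
      Nat.cast_succ, add_sub_cancel_right, ih, leafCount_cons]
    push_cast; ring

theorem leftCoord_length (L : List (BinaryTree Unit)) : leftCoord L L.length = leafCount L := by
  induction L with
  | nil => simp [leftCoord]
  | cons r L ih =>
    have : (0 : ℝ) ≤ L.length := Nat.cast_nonneg _
    rw [leftCoord_cons_ge (by rw [List.length_cons]; push_cast; linarith), List.length_cons,
      Nat.cast_succ, add_sub_cancel_right, ih, leafCount_cons]
    push_cast; ring

theorem zipForest_firstLeaf_length (ls rs : List (BinaryTree Unit)) :
    (zipForest ls rs).firstLeaf rs.length = leafCount rs := by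
  have := firstLeaf_of_zipTree (T := zipForest ls rs) (ls := ls) (rs := rs) (fun _ => rfl) rs.length
  rw [Int.cast_natCast, zipCoord_nonneg (Nat.cast_nonneg _), rightCoord_length] at this
  have : (((zipForest ls rs).firstLeaf rs.length : ℤ) : ℝ) = leafCount rs := by linarith
  exact_mod_cast this

theorem zipForest_firstLeaf_neg_length (ls rs : List (BinaryTree Unit)) :
    (zipForest ls rs).firstLeaf (-ls.length) = -leafCount ls := by
  have := firstLeaf_of_zipTree (T := zipForest ls rs) (ls := ls) (rs := rs) (fun _ => rfl)
    (-ls.length)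
  rw [Int.cast_neg, Int.cast_natCast, zipCoord_nonpos (by simp), neg_neg,
    leftCoord_length] at this
  have : (((zipForest ls rs).firstLeaf (-ls.length) : ℤ) : ℝ) = -leafCount ls := by linarith
  exact_mod_cast this

theorem zipDiagram_width_le {ls rs : List (BinaryTree Unit)} {n : ℕ} (hrs : rs ≠ [])
    (hn : leafCount ls + leafCount rs = n + 1) : (zipDiagram ls rs).width ≤ n := by
  -- The interval made up of all `n + 1` leaves of the zipper. Its first leaf, `-leafCount ls` in
  -- the top numbering, matches the bottom pointer; `rs ≠ []` keeps the top pointer inside.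
  refine Nat.sInf_le ⟨-leafCount ls, ?_, ?_⟩
  · intro i hi
    have hm := (zipForest ls rs).firstLeaf_mono
    have h1 : -(ls.length : ℤ) ≤ i := by
      by_contra hc
      have h0 : i ≠ 0 := by omega
      apply hi.resolve_left h0
      cases i with
      | ofNat m => simp at hc
      | negSucc m => exact List.getD_eq_default _ _ (by omega)
    have h2 : i + 1 ≤ rs.length := by
      by_contra hc
      have := List.length_pos_iff.2 hrs
      have h0 : i ≠ 0 := by omega
      apply hi.resolve_left h0
      cases i with
      | ofNat m => exact List.getD_eq_default _ _ (by simp at hc; omega)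
      | negSucc m => omega
    have h3 := hm h1
    have h4 := hm h2
    rw [zipForest_firstLeaf_neg_length] at h3
    rw [zipForest_firstLeaf_length] at h4
    simp only [zipDiagram]
    constructor <;> omega
  · intro i hi
    have h0 : i = 0 := hi.resolve_right fun h => h (zipTree_nil_nil i)
    subst h0
    have h1 : (zipDiagram ls rs).bottom.firstLeaf 0 = 0 := Forest.firstLeaf_zero _
    have h2 : (zipDiagram ls rs).bottom.firstLeaf 1 = 1 :=
      Forest.firstLeaf_of_trivial (T := (zipDiagram ls rs).bottom) zipTree_nil_nil 1
    rw [zero_add, h1, h2]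
    simp only [zipDiagram]
    constructor <;> omega

/-- The set whose infimum defines the width is nonempty, so the width is attained rather than being
the default `0`. -/
theorem ForestDiagram.exists_supportedIn (D : ForestDiagram) :
    ∃ (w : ℕ) (a : ℤ), D.SupportedIn a (a + w) := by
  have bound : ∀ (T : Forest), ∃ N : ℕ, ∀ i, (i = 0 ∨ T.tree i ≠ .nil) →
      -(N : ℤ) ≤ T.firstLeaf i ∧ T.firstLeaf (i + 1) - 1 ≤ N := by
    intro T
    have hfin : {i | i = 0 ∨ T.tree i ≠ .nil}.Finite := by
      have : {i | i = 0 ∨ T.tree i ≠ .nil} = {0} ∪ {i | T.tree i ≠ .nil} := by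
        ext i; simp
      rw [this]
      exact (Set.finite_singleton 0).union T.bounded
    refine ⟨∑ i ∈ hfin.toFinset, ((T.firstLeaf i).natAbs + (T.firstLeaf (i + 1)).natAbs),
      fun i hi => ?_⟩
    have := Finset.single_le_sum (f := fun i => (T.firstLeaf i).natAbs +
      (T.firstLeaf (i + 1)).natAbs) (fun _ _ => Nat.zero_le _) (hfin.mem_toFinset.2 hi)
    constructor <;> omega
  obtain ⟨N, hN⟩ := bound D.top
  obtain ⟨M, hM⟩ := bound D.bottom
  obtain ⟨K, hK, hK'⟩ : ∃ K : ℕ, -(K : ℤ) ≤ D.shift ∧ D.shift ≤ K :=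
    ⟨D.shift.natAbs, by omega, by omega⟩
  refine ⟨2 * (N + M + K), -(N + M + K), fun i hi => ?_, fun i hi => ?_⟩
  · have := hN i hi
    constructor <;> push_cast <;> omega
  · have := hM i hi
    constructor <;> push_cast <;> omega

theorem ForestDiagram.exists_supportedIn_width (D : ForestDiagram) :
    ∃ a : ℤ, D.SupportedIn a (a + D.width) :=
  Nat.sInf_mem (s := {w : ℕ | ∃ a : ℤ, D.SupportedIn a (a + w)}) D.exists_supportedIn

end Thompson

namespace Thompson

/-! ## Positive elements -/

/-- The tree whose left spine carries the trees of the list, from top to bottom. -/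
def leftComb : List (BinaryTree Unit) → BinaryTree Unit
  | [] => .nil
  | r :: L => .node () (leftComb L) r

/-- The tree whose right spine carries the trees of the list, from top to bottom. -/
def rightComb : List (BinaryTree Unit) → BinaryTree Unit
  | [] => .nil
  | r :: L => .node () r (rightComb L)

/-- The right vine with `N` carets. -/
def vine (N : ℕ) : BinaryTree Unit := rightComb (List.replicate N .nil)

theorem numLeaves_leftComb (L : List (BinaryTree Unit)) :
    (leftComb L).numLeaves = leafCount L + 1 := by
  induction L with
  | nil => rfl
  | cons r L ih => rw [leftComb, BinaryTree.numLeaves, ih, leafCount_cons]; omega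

theorem numLeaves_rightComb (L : List (BinaryTree Unit)) :
    (rightComb L).numLeaves = leafCount L + 1 := by
  induction L with
  | nil => rfl
  | cons r L ih => rw [rightComb, BinaryTree.numLeaves, ih, leafCount_cons]; omega

theorem exists_leftComb (T : BinaryTree Unit) : ∃ L, T = leftComb L := by
  induction T with
  | nil => exact ⟨[], rfl⟩
  | node u A B hA _ =>
    obtain ⟨L, rfl⟩ := hA
    exact ⟨B :: L, rfl⟩

theorem exists_rightComb (T : BinaryTree Unit) : ∃ L, T = rightComb L := by
  induction T with
  | nil => exact ⟨[], rfl⟩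
  | node u A B _ hB =>
    obtain ⟨L, rfl⟩ := hB
    exact ⟨A :: L, rfl⟩

theorem vine_succ (N : ℕ) : vine (N + 1) = .node () .nil (vine N) := rfl

theorem numLeaves_vine (N : ℕ) : (vine N).numLeaves = N + 1 := by
  rw [vine, numLeaves_rightComb]
  simp [leafCount, BinaryTree.numLeaves]

theorem isRightVine_vine (N : ℕ) : IsRightVine (vine N) := by
  induction N with
  | zero => trivial
  | succ N ih => exact ⟨rfl, ih⟩

theorem IsRightVine.exists_eq_vine {U : BinaryTree Unit} (h : IsRightVine U) :
    ∃ N, U = vine N := by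
  induction U with
  | nil => exact ⟨0, rfl⟩
  | node u L R _ hR =>
    obtain ⟨rfl, h2⟩ := h
    obtain ⟨N, rfl⟩ := hR h2
    exact ⟨N + 1, rfl⟩

theorem two_mul_psi_sub_one_of_le {t : ℝ} (h0 : 0 ≤ t) (h1 : t ≤ 1) :
    2 * psi t - 1 = t / 2 := by
  rw [psi_eq_of_mem (by linarith) h1]; ring

theorem two_mul_psi_sub_one_of_ge {t : ℝ} (h : 1 ≤ t) : 2 * psi t - 1 = psi (t - 1) := by
  have := psi_add_one (t := t - 1) (by linarith)
  rw [sub_add_cancel] at this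
  linarith

theorem psi_zero : psi 0 = 1 / 2 := by
  rw [psi_eq_of_mem (by norm_num) (by norm_num)]; norm_num

theorem treeCoord_node_psi_le {A B : BinaryTree Unit} {t : ℝ} (h0 : 0 ≤ t) (h1 : t ≤ 1) :
    treeCoord (.node () A B) (2 * psi t - 1) = treeCoord A t := by
  rw [two_mul_psi_sub_one_of_le h0 h1, treeCoord_node_left (by linarith),
    mul_div_cancel₀ _ (by norm_num : (2 : ℝ) ≠ 0)]

theorem treeCoord_node_psi_ge {A B : BinaryTree Unit} {t : ℝ} (h : 1 ≤ t) :
    treeCoord (.node () A B) (2 * psi t - 1) =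
      A.numLeaves + treeCoord B (2 * psi (t - 1) - 1) := by
  rw [two_mul_psi_sub_one_of_ge h, treeCoord_node_right (half_le_psi (by linarith)).1]

/-- `psi` sends `[i, i+1]`, `i ≥ 0`, to the successive left children along the right spine of the
right half of `[0,1]`. The factor `2 * · - 1` rescales that half, and on it the vine undoes `psi`.
-/
theorem treeCoord_vine {N : ℕ} {y : ℝ} (h0 : 0 ≤ y) (h1 : y ≤ N) :
    treeCoord (vine N) (2 * psi y - 1) = y := by
  induction N generalizing y with
  | zero =>
    have : y = 0 := le_antisymm (by simpa using h1) h0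
    rw [this, psi_zero]
    norm_num [treeCoord_zero]
  | succ N ih =>
    rw [vine_succ]
    rcases le_total y 1 with h | h
    · rw [treeCoord_node_psi_le h0 h]; rfl
    · rw [treeCoord_node_psi_ge h, ih (by linarith) (by push_cast at h1; linarith)]
      simp [BinaryTree.numLeaves]

theorem treeCoord_vine_add (l N : ℕ) {y : ℝ} (h0 : 0 ≤ y) :
    treeCoord (vine (l + N)) (2 * psi (l + y) - 1) = l + treeCoord (vine N) (2 * psi y - 1) := by
  induction l with
  | zero => simp
  | succ l ih =>
    have : (0 : ℝ) ≤ l := l.cast_nonneg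
    rw [show l + 1 + N = (l + N) + 1 by ring, vine_succ,
      treeCoord_node_psi_ge (by push_cast; linarith),
      show ((l + 1 : ℕ) : ℝ) + y - 1 = l + y by push_cast; ring, ih]
    simp only [BinaryTree.numLeaves]
    push_cast; ring

theorem rightCoord_nonneg (L : List (BinaryTree Unit)) {t : ℝ} (h : 0 ≤ t) :
    0 ≤ rightCoord L t := by
  induction L generalizing t with
  | nil => exact h
  | cons r L ih =>
    rcases le_total t 1 with h1 | h1
    · rw [rightCoord_cons_le h1]; exact (treeCoord_mem h h1).1
    · rw [rightCoord_cons_ge h1]; exact add_nonneg (Nat.cast_nonneg _) (ih (by linarith))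

theorem leftCoord_nonneg (L : List (BinaryTree Unit)) {t : ℝ} (h : 0 ≤ t) :
    0 ≤ leftCoord L t := by
  induction L generalizing t with
  | nil => exact h
  | cons r L ih =>
    rcases le_total t 1 with h1 | h1
    · rw [leftCoord_cons_le h1]
      linarith [(treeCoord_mem (T := r) (x := 1 - t) (by linarith) (by linarith)).2]
    · rw [leftCoord_cons_ge h1]; exact add_nonneg (Nat.cast_nonneg _) (ih (by linarith))

theorem treeCoord_rightComb (L : List (BinaryTree Unit)) {t : ℝ} (h : 0 ≤ t) :
    treeCoord (rightComb L) (2 * psi t - 1) =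
      treeCoord (vine (leafCount L)) (2 * psi (rightCoord L t) - 1) := by
  induction L generalizing t with
  | nil => rfl
  | cons r L ih =>
    rw [rightComb, leafCount_cons]
    rcases le_total t 1 with h1 | h1
    · have := treeCoord_mem (T := r) h h1
      rw [treeCoord_node_psi_le h h1, rightCoord_cons_le h1, treeCoord_vine this.1]
      push_cast
      linarith [(Nat.cast_nonneg (leafCount L) : (0 : ℝ) ≤ _)]
    · rw [treeCoord_node_psi_ge h1, ih (by linarith), rightCoord_cons_ge h1,
        treeCoord_vine_add _ _ (rightCoord_nonneg L (by linarith))]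

/-- The second case is the first leaf of the comb, the image of the whole tail to the left of the
listed trees. In the first case that leaf has been passed, hence the summand `1`. -/
theorem treeCoord_leftComb (L : List (BinaryTree Unit)) {t : ℝ} (h : 0 ≤ t) :
    treeCoord (leftComb L) (2 * psi (-t)) =
      if leftCoord L t ≤ leafCount L then 1 + (leafCount L - leftCoord L t)
      else 2 * psi (leafCount L - leftCoord L t) := by
  induction L generalizing t with
  | nil =>
    simp only [leftComb, treeCoord, leftCoord, leafCount_nil, Nat.cast_zero, zero_sub]
    split_ifs with h1
    · rw [le_antisymm h1 h, neg_zero, psi_zero]; norm_num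
    · rfl
  | cons r L ih =>
    rw [leftComb, leafCount_cons]
    rcases le_total t 1 with h1 | h1
    · have h2 := treeCoord_mem (T := r) (x := 1 - t) (by linarith) (by linarith)
      have h3 : (0 : ℝ) ≤ leafCount L := Nat.cast_nonneg _
      rw [psi_eq_of_mem (by linarith) (by linarith), treeCoord_node_right (by linarith),
        numLeaves_leftComb, leftCoord_cons_le h1, if_pos (by push_cast; linarith),
        show 2 * (2 * (1 / 2 + -t / 4)) - 1 = 1 - t by ring]
      push_cast; ring
    · have h2 := psi_sub_one (t := -(t - 1)) (by linarith)
      have h3 := half_le_psi (t := t - 1) (by linarith)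
      have h4 := psi_neg (t := t - 1) (by linarith)
      rw [show -t = -(t - 1) - 1 by ring, h2, treeCoord_node_left (by linarith),
        mul_div_cancel₀ _ (by norm_num : (2 : ℝ) ≠ 0), ih (by linarith), leftCoord_cons_ge h1]
      push_cast
      simp only [add_le_add_iff_left, add_sub_add_left_eq_sub]

/-- The root caret cuts at `psi 0 = 1/2`, the pointer. Thus the spines of the top tree carry `ls`
and `rs`, and the first leaf of the vine is the half-line left of the bottom pointer. -/
theorem treeCoord_vine_zipCoord (ls rs : List (BinaryTree Unit)) (s : ℝ) :
    treeCoord (vine (leafCount ls + leafCount rs + 1)) (psi (zipCoord ls rs s)) =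
      treeCoord (.node () (leftComb ls) (rightComb rs)) (psi s) := by
  rw [vine_succ]
  rcases le_total 0 s with h | h
  · have h1 := rightCoord_nonneg rs h
    have h2 : (0 : ℝ) ≤ leafCount ls := Nat.cast_nonneg _
    rw [zipCoord_nonneg h, treeCoord_node_right (half_le_psi h).1,
      treeCoord_node_right (half_le_psi (by linarith)).1, treeCoord_vine_add _ _ h1,
      treeCoord_rightComb rs h, numLeaves_leftComb]
    simp only [BinaryTree.numLeaves]
    push_cast; ring
  · have h1 := leftCoord_nonneg ls (t := -s) (by linarith)
    have h2 : psi s ≤ 1 / 2 := by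
      rw [← psi_zero]; exact psi_strictMono.monotone h
    have h3 := treeCoord_leftComb ls (t := -s) (by linarith)
    rw [neg_neg] at h3
    rw [zipCoord_nonpos h, treeCoord_node_left h2, h3]
    split_ifs with h4
    · rw [treeCoord_node_right (half_le_psi (by linarith)).1, treeCoord_vine (by linarith)]
      · simp [BinaryTree.numLeaves]
      · push_cast
        linarith [(Nat.cast_nonneg (leafCount rs) : (0 : ℝ) ≤ _)]
    · rw [treeCoord_node_left]
      · rfl
      · rw [← psi_zero]
        exact psi_strictMono.monotone (by linarith)

/-- The tree diagram equation becomes the zipper equation because the coordinate of the vine is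
injective. -/
theorem isTreeDiagram_iff_realizes {ls rs : List (BinaryTree Unit)} {f : F} :
    IsTreeDiagram (.node () (leftComb ls) (rightComb rs))
      (vine (leafCount ls + leafCount rs + 1)) f ↔ Realizes ls rs f := by
  have hl : (BinaryTree.node () (leftComb ls) (rightComb rs)).numLeaves =
      (vine (leafCount ls + leafCount rs + 1)).numLeaves := by
    rw [BinaryTree.numLeaves, numLeaves_vine, numLeaves_leftComb, numLeaves_rightComb]
    omega
  constructor
  · rintro ⟨-, h⟩ s x hx
    have h1 := h x
    rw [hx, ← treeCoord_vine_zipCoord] at h1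
    have h2 := psi_mem (zipCoord ls rs s)
    exact (treeCoord_strictMonoOn _).injOn ((f : unitInterval ≃o unitInterval) x).2
      ⟨h2.1.le, h2.2.le⟩ h1
  · intro h
    refine ⟨hl, fun x => ?_⟩
    rcases eq_zero_or_one_or_psi x with rfl | rfl | ⟨s, hs⟩
    · rw [orderIso_zero]
      simp only [Set.Icc.coe_zero, treeCoord_zero]
    · rw [orderIso_one]
      simp only [Set.Icc.coe_one, treeCoord_one, hl]
    · rw [h s x hs, hs, treeCoord_vine_zipCoord]

theorem zipCoord_nil_nil (s : ℝ) : zipCoord [] [] s = s := by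
  rcases le_total 0 s with h | h
  · rw [zipCoord_nonneg h, rightCoord]; simp
  · rw [zipCoord_nonpos h, leftCoord]; simp

/-- Any nontrivial top tree splits at its root into a left comb and a right comb, whose trees form
the zipper. -/
theorem IsPositive.exists_realizes {f : F} (h : IsPositive f) : ∃ ls rs, Realizes ls rs f := by
  obtain ⟨T, U, hd, -, hU⟩ := h
  obtain ⟨N, rfl⟩ := hU.exists_eq_vine
  cases T with
  | nil =>
    obtain ⟨h1, h2⟩ := hd
    have hN : N = 0 := by
      rw [numLeaves_vine] at h1; simpa [BinaryTree.numLeaves] using h1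
    subst hN
    refine ⟨[], [], fun s x hx => ?_⟩
    rw [zipCoord_nil_nil, ← hx]
    exact h2 x
  | node u A B =>
    obtain ⟨ls, rfl⟩ := exists_leftComb A
    obtain ⟨rs, rfl⟩ := exists_rightComb B
    have hN : N = leafCount ls + leafCount rs + 1 := by
      have := hd.1
      rw [numLeaves_vine, BinaryTree.numLeaves, numLeaves_leftComb, numLeaves_rightComb] at this
      omega
    subst hN
    exact ⟨ls, rs, isTreeDiagram_iff_realizes.1 hd⟩

/-! ### Reducedness of tree diagrams over a right vine. -/

theorem HasCaret.add_two_le {T : BinaryTree Unit} {j : ℕ} (h : HasCaret T j) :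
    j + 2 ≤ T.numLeaves := by
  induction T generalizing j with
  | nil => exact h.elim
  | node u L R hL hR =>
    have h1 := L.numLeaves_pos
    have h2 := R.numLeaves_pos
    rw [BinaryTree.numLeaves]
    rcases h with ⟨-, -, rfl⟩ | h | ⟨h, h'⟩
    · omega
    · have := hL h; omega
    · have := hR h'; omega

/-- A vine can only be opposed at its last two leaves. -/
theorem hasCaret_vine {N j : ℕ} (h : HasCaret (vine N) j) : j + 1 = N := by
  induction N generalizing j with
  | zero => exact h.elim
  | succ N ih =>
    rcases h with ⟨-, h, rfl⟩ | h | ⟨h, h'⟩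
    · cases N with
      | zero => rfl
      | succ N => rw [← vine, vine_succ] at h; cases h
    · exact h.elim
    · have := ih h'
      simp only [BinaryTree.numLeaves] at this h
      omega

/-- The comb ends in one extra leaf after the listed trees, and this leaf forms a caret with its
predecessor only if the last listed tree is trivial. -/
theorem not_hasCaret_rightComb {L : List (BinaryTree Unit)}
    (hL : ∀ h : L ≠ [], L.getLast h ≠ .nil) {j : ℕ} (hj : j + 1 = leafCount L) :
    ¬ HasCaret (rightComb L) j := by
  induction L generalizing j with
  | nil => exact fun h => h
  | cons r L ih =>
    intro h
    rw [leafCount_cons] at hj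
    rcases h with ⟨h1, h2, -⟩ | h | ⟨h, h'⟩
    · cases L with
      | nil => exact hL (by simp) (by simpa using h1)
      | cons a L => cases h2
    · have := h.add_two_le
      omega
    · cases L with
      | nil => exact h'
      | cons a L =>
        exact ih (fun h => by simpa [List.getLast_cons h] using hL (by simp)) (by omega) h'

theorem exists_trimmed (L : List (BinaryTree Unit)) : ∃ L' : List (BinaryTree Unit),
    (∀ i, L'.getD i .nil = L.getD i .nil) ∧ ∀ h : L' ≠ [], L'.getLast h ≠ .nil := by
  induction L with
  | nil => exact ⟨[], fun _ => rfl, fun h => absurd rfl h⟩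
  | cons r L ih =>
    obtain ⟨L', h1, h2⟩ := ih
    by_cases hr : L' = [] ∧ r = .nil
    · obtain ⟨rfl, rfl⟩ := hr
      refine ⟨[], fun i => ?_, fun h => absurd rfl h⟩
      cases i with
      | zero => rfl
      | succ i => simpa using h1 i
    · refine ⟨r :: L', fun i => ?_, fun h => ?_⟩
      · cases i with
        | zero => rfl
        | succ i => simpa using h1 i
      · by_cases hL : L' = []
        · subst hL
          simpa using hr
        · rw [List.getLast_cons hL]
          exact h2 hL

/-- Dropping the trailing trivial trees of `rs` removes the only possible opposing caret, at the
right end of the vine. -/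
theorem Realizes.isPositive {ls rs : List (BinaryTree Unit)} {f : F} (hf : Realizes ls rs f) :
    IsPositive f := by
  obtain ⟨L, h1, h2⟩ := exists_trimmed rs
  replace hf := hf.congr (zipCoord_eq_of_getD_eq (ls := ls) h1)
  by_cases hn : ls = [] ∧ L = []
  · obtain ⟨rfl, rfl⟩ := hn
    refine ⟨.nil, .nil, ⟨rfl, fun x => ?_⟩, fun j h => h.1, trivial⟩
    simp only [treeCoord]
    rcases eq_zero_or_one_or_psi x with rfl | rfl | ⟨s, hs⟩
    · rw [orderIso_zero]
    · rw [orderIso_one]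
    · rw [hf s x hs, hs, zipCoord_nil_nil]
  · refine ⟨_, _, isTreeDiagram_iff_realizes.2 hf, ?_, isRightVine_vine _⟩
    rintro j ⟨h, h'⟩
    have hj := hasCaret_vine h'
    rcases h with ⟨h3, h4, -⟩ | h | ⟨h, h3⟩
    · apply hn
      constructor
      · cases ls with
        | nil => rfl
        | cons => cases h3
      · cases L with
        | nil => rfl
        | cons => cases h4
    · have := h.add_two_le
      rw [numLeaves_leftComb] at this
      omega
    · rw [numLeaves_leftComb] at h h3
      exact not_hasCaret_rightComb h2 (by omega) h3

/-! ## The sets `S n k` -/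

/-- The zippers with `n + 1` leaves and all trees of height at most `k`. -/
def zipSet (n k : ℕ) : Set (List (BinaryTree Unit) × List (BinaryTree Unit)) :=
  {z | z.2 ≠ [] ∧ leafCount z.1 + leafCount z.2 = n + 1 ∧
    (∀ T ∈ z.1, T.height ≤ k) ∧ ∀ T ∈ z.2, T.height ≤ k}

/-- The support reaches left to the bottom pointer, which is where `ls` begins. So width at most `n`
means that `n + 1` leaves counted from there suffice, and unused places are filled with trivial
trees on the right. -/
theorem mem_S_iff {n k : ℕ} {f : F} : f ∈ S n k ↔ ∃ z ∈ zipSet n k, Realizes z.1 z.2 f := by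
  constructor
  · rintro ⟨hp, D, hD, hr, hw, hh⟩
    obtain ⟨ls, rs, hf⟩ := hp.exists_realizes
    have hb := ForestDiagram.bottom_trivial hf hD hr
    have hs := ForestDiagram.shift_eq hf hD hr
    have ht := ForestDiagram.top_tree hf hD hr
    obtain ⟨a, ha1, ha2⟩ := D.exists_supportedIn_width
    -- The bottom pointer bounds the left end of the support: `a ≤ -leafCount ls`.
    have h1 := (ha2 0 (Or.inl rfl)).1
    rw [Forest.firstLeaf_zero, hs] at h1
    have h2 : ∀ i, (i = 0 ∨ zipTree ls rs i ≠ .nil) →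
        D.top.firstLeaf (i + 1) + leafCount ls ≤ n + 1 := by
      intro i hi
      rw [← ht] at hi
      have := (ha1 i hi).2
      omega
    -- The tree at the top pointer takes at least one leaf, which later makes the padded right list
    -- nonempty.
    have h3 : leafCount ls + 1 ≤ n + 1 := by
      have := h2 0 (Or.inl rfl)
      rw [D.top.firstLeaf_add_one, D.top.firstLeaf_zero] at this
      have h4 := (D.top.tree 0).numLeaves_pos
      omega
    obtain ⟨L, hL1, hL2⟩ := exists_leafCount_eq rs (M := n + 1 - leafCount ls) (fun i hi => by
      have h4 := h2 i (Or.inr hi)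
      have h5 := firstLeaf_of_zipTree ht (i + 1)
      push_cast at h5
      rw [zipCoord_nonneg (by positivity)] at h5
      have h6 : ((D.top.firstLeaf (i + 1) : ℤ) : ℝ) + leafCount ls ≤ n + 1 := by
        exact_mod_cast h4
      rw [Nat.cast_sub (by omega)]
      push_cast
      linarith)
    refine ⟨(ls, L), ⟨?_, by simp only [hL1]; omega, ?_, ?_⟩,
      hf.congr (zipCoord_eq_of_getD_eq hL2)⟩
    · rintro rfl
      simp at hL1
      omega
    · refine height_le_of_getD fun m => ?_
      have := (hh (Int.negSucc m)).1
      rwa [ht] at this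
    · refine height_le_of_getD fun m => ?_
      have := (hh (Int.ofNat m)).1
      rw [ht] at this
      rw [hL2]
      exact this
  · rintro ⟨⟨ls, rs⟩, ⟨h1, h2, h3, h4⟩, hf⟩
    refine ⟨hf.isPositive, zipDiagram ls rs, zipDiagram_represents hf, zipDiagram_isReduced ls rs,
      zipDiagram_width_le h1 h2, fun i => ⟨height_zipTree_le h3 h4 i, ?_⟩⟩
    rw [show (zipDiagram ls rs).bottom.tree i = .nil from zipTree_nil_nil i]
    exact Nat.zero_le k

end Thompson

/-! ## Counting boundary edges -/

open Classical in
-- Multiplication by `g⁻¹` is a bijection between the elements that stay in `S` under `g⁻¹` and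
-- those that stay under `g`; compare complements.
theorem card_filter_mul_not_mem_inv {G : Type*} [Group G] (S : Finset G) (g : G) :
    (S.filter fun f => f * g⁻¹ ∉ S).card = (S.filter fun f => f * g ∉ S).card := by
  have key : (S.filter fun f => f * g⁻¹ ∈ S).card = (S.filter fun f => f * g ∈ S).card := by
    refine Finset.card_bij' (fun f _ => f * g⁻¹) (fun f _ => f * g) ?_ ?_ ?_ ?_
    · intro f hf
      simp only [Finset.mem_filter] at hf ⊢
      exact ⟨hf.2, by simpa using hf.1⟩
    · intro f hf
      simp only [Finset.mem_filter] at hf ⊢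
      exact ⟨hf.2, by simpa using hf.1⟩
    · intro f _; simp
    · intro f _; simp
  have h1 := S.card_filter_add_card_filter_not (fun f => f * g⁻¹ ∈ S)
  have h2 := S.card_filter_add_card_filter_not (fun f => f * g ∈ S)
  omega

/-- The hypotheses make `x, x⁻¹, y, y⁻¹` distinct. Each boundary edge has one endpoint in `S` and
leaves it along exactly one of them; the inverse directions contribute equally, hence the factors
`2`. -/
theorem ncard_edgeBoundary {G : Type*} [Group G] {x y : G} (hx : x * x ≠ 1) (hy : y * y ≠ 1)
    (hxy : x ≠ y) (hxy' : x * y ≠ 1) {S : Set G} (hS : S.Finite) :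
    (edgeBoundary {x, y} S).ncard =
      2 * {f ∈ S | f * x ∉ S}.ncard + 2 * {f ∈ S | f * y⁻¹ ∉ S}.ncard := by
  classical
  obtain ⟨S, rfl⟩ := hS.exists_finset_coe
  have e1 : x ≠ x⁻¹ := fun h => hx (by nth_rw 2 [h]; exact mul_inv_cancel x)
  have e2 : y ≠ y⁻¹ := fun h => hy (by nth_rw 2 [h]; exact mul_inv_cancel y)
  have e3 : x ≠ y⁻¹ := fun h => hxy' (by rw [h]; exact inv_mul_cancel y)
  have e4 : x⁻¹ ≠ y := fun h => e3 (by rw [← h, inv_inv])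
  have e5 : x⁻¹ ≠ y⁻¹ := fun h => hxy (inv_injective h)
  set A : Finset (G × G) := (({x, x⁻¹, y, y⁻¹} : Finset G) ×ˢ S).filter fun q => q.2 * q.1 ∉ S
    with hA
  have hb : edgeBoundary {x, y} (S : Set G) = (fun q : G × G => s(q.2, q.2 * q.1)) '' A := by
    ext e
    constructor
    · rintro ⟨he, a, ha, b, hb, rfl⟩
      rw [SimpleGraph.mem_edgeSet, SimpleGraph.mulCayley_adj'] at he
      obtain ⟨-, g, hg, h⟩ := he
      refine ⟨(a⁻¹ * b, a), ?_, by simp⟩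
      have : a⁻¹ * b = g ∨ a⁻¹ * b = g⁻¹ := by
        rcases h with rfl | rfl
        · left; group
        · right; group
      simp only [Set.mem_insert_iff, Set.mem_singleton_iff] at hg
      simp only [hA, Finset.coe_filter, Finset.mem_product, Finset.mem_insert,
        Finset.mem_singleton, Set.mem_ofPred_eq, mul_inv_cancel_left]
      refine ⟨⟨?_, ha⟩, hb⟩
      rcases hg with rfl | rfl <;> rcases this with h | h <;> simp [h]
    · rintro ⟨⟨g, f⟩, hq, rfl⟩
      simp only [hA, Finset.coe_filter, Finset.mem_product, Finset.mem_insert,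
        Finset.mem_singleton, Set.mem_ofPred_eq] at hq
      obtain ⟨⟨hg, hf⟩, hn⟩ := hq
      refine ⟨?_, f, hf, f * g, hn, rfl⟩
      rw [SimpleGraph.mem_edgeSet, SimpleGraph.mulCayley_adj']
      refine ⟨fun h => hn (h ▸ hf), ?_⟩
      rcases hg with rfl | rfl | rfl | rfl
      · exact ⟨_, by simp, Or.inl rfl⟩
      · exact ⟨x, by simp, Or.inr (by simp)⟩
      · exact ⟨_, by simp, Or.inl rfl⟩
      · exact ⟨y, by simp, Or.inr (by simp)⟩
  have hinj : Set.InjOn (fun q : G × G => s(q.2, q.2 * q.1)) A := by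
    rintro ⟨g, f⟩ hq ⟨g', f'⟩ hq' h
    simp only [hA, Finset.coe_filter, Finset.mem_product, Set.mem_ofPred_eq] at hq hq'
    rw [Sym2.eq_iff] at h
    rcases h with ⟨rfl, h⟩ | ⟨h, -⟩
    · simpa using h
    · exact absurd (h ▸ hq.1.2) hq'.2
  have hcard : A.card = ∑ g ∈ ({x, x⁻¹, y, y⁻¹} : Finset G), (S.filter fun f => f * g ∉ S).card := by
    rw [hA, Finset.card_filter, Finset.sum_product]
    exact Finset.sum_congr rfl fun g _ => (Finset.card_filter _ _).symm
  have hset : ∀ g : G, {f ∈ (S : Set G) | f * g ∉ (S : Set G)}.ncard =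
      (S.filter fun f => f * g ∉ S).card := by
    intro g
    rw [← Set.ncard_coe_finset]
    congr 1
    ext f; simp
  rw [hb, hinj.ncard_image, Set.ncard_coe_finset, hcard, hset, hset,
    Finset.sum_insert (by simp [e1, hxy, e3]), Finset.sum_insert (by simp [e4, hxy]),
    Finset.sum_insert (by simp [e2]), Finset.sum_singleton, card_filter_mul_not_mem_inv S x,
    card_filter_mul_not_mem_inv S y]
  ring

namespace Thompson

/-! ## Counting trees and forests -/

/-- The trees of height at most `k`. -/
def treesOfHeightLE : ℕ → Finset (BinaryTree Unit)
  | 0 => {.nil}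
  | k + 1 => insert .nil ((treesOfHeightLE k ×ˢ treesOfHeightLE k).image
      fun q => .node () q.1 q.2)

theorem mem_treesOfHeightLE {k : ℕ} {T : BinaryTree Unit} :
    T ∈ treesOfHeightLE k ↔ T.height ≤ k := by
  induction k generalizing T with
  | zero =>
    cases T with
    | nil => simp [treesOfHeightLE, BinaryTree.height]
    | node u L R => simp [treesOfHeightLE, BinaryTree.height]
  | succ k ih =>
    cases T with
    | nil => simp [treesOfHeightLE, BinaryTree.height]
    | node u L R => simp [treesOfHeightLE, BinaryTree.height, ih]

theorem numLeaves_le_two_pow_height (T : BinaryTree Unit) : T.numLeaves ≤ 2 ^ T.height := by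
  induction T with
  | nil => simp [BinaryTree.numLeaves, BinaryTree.height]
  | node u L R hL hR =>
    rw [BinaryTree.numLeaves, BinaryTree.height, pow_succ, mul_two]
    exact add_le_add (hL.trans (Nat.pow_le_pow_right (by norm_num) (le_max_left _ _)))
      (hR.trans (Nat.pow_le_pow_right (by norm_num) (le_max_right _ _)))

theorem numLeaves_le_of_mem {k : ℕ} {T : BinaryTree Unit} (h : T ∈ treesOfHeightLE k) :
    T.numLeaves ≤ 2 ^ k :=
  (numLeaves_le_two_pow_height T).trans
    (Nat.pow_le_pow_right (by norm_num) (mem_treesOfHeightLE.1 h))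

theorem treePoly_eq_sum (k : ℕ) (p : ℝ) :
    treePoly k p = ∑ T ∈ treesOfHeightLE k, p ^ T.numLeaves := by
  have hm : ∀ T ∈ treesOfHeightLE k, T.numLeaves ∈ Finset.Icc 1 (2 ^ k) := fun T hT =>
    Finset.mem_Icc.2 ⟨T.numLeaves_pos, numLeaves_le_of_mem hT⟩
  rw [treePoly, ← Finset.sum_fiberwise_of_maps_to hm]
  refine Finset.sum_congr rfl fun l _ => ?_
  have : treeCount l k = ((treesOfHeightLE k).filter fun T => T.numLeaves = l).card := by
    rw [treeCount, ← Set.ncard_coe_finset]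
    congr 1
    ext T
    simp [mem_treesOfHeightLE, and_comm]
  rw [this, Finset.sum_congr rfl (g := fun _ => p ^ l)
    (fun T hT => by rw [(Finset.mem_filter.1 hT).2]), Finset.sum_const, nsmul_eq_mul]

theorem treePoly_zero (p : ℝ) : treePoly 0 p = p := by
  rw [treePoly_eq_sum]
  simp [treesOfHeightLE, BinaryTree.numLeaves]

theorem treePoly_succ (k : ℕ) (p : ℝ) : treePoly (k + 1) p = p + treePoly k p ^ 2 := by
  rw [treePoly_eq_sum, treePoly_eq_sum, treesOfHeightLE, Finset.sum_insert (by simp),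
    Finset.sum_image, Finset.sum_product, sq, Finset.sum_mul_sum]
  · simp [BinaryTree.numLeaves, pow_add]
  · rintro ⟨a, b⟩ _ ⟨c, d⟩ _ h
    simpa using h

/-- The lists of trees of height at most `k` with `m` leaves altogether. -/
def forestSet (k m : ℕ) : Set (List (BinaryTree Unit)) :=
  {L | leafCount L = m ∧ ∀ T ∈ L, T.height ≤ k}

theorem forestSet_finite (k m : ℕ) : (forestSet k m).Finite := by
  induction m using Nat.strong_induction_on with
  | _ m ih =>
    have h : (⋃ T ∈ (treesOfHeightLE k : Set (BinaryTree Unit)), ⋃ j ∈ Set.Iio m,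
        (T :: ·) '' forestSet k j).Finite :=
      (treesOfHeightLE k).finite_toSet.biUnion fun T _ =>
        (Set.finite_Iio m).biUnion fun j hj => (ih j hj).image _
    refine (h.insert []).subset ?_
    rintro (_ | ⟨T, L⟩) ⟨h1, h2⟩
    · exact Or.inl rfl
    · right
      rw [leafCount_cons] at h1
      have := T.numLeaves_pos
      simp only [Set.mem_iUnion]
      exact ⟨T, mem_treesOfHeightLE.2 (h2 T (by simp)), leafCount L,
        by simp only [Set.mem_Iio]; omega, L, ⟨rfl, fun U hU => h2 U (by simp [hU])⟩, rfl⟩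

/-- `forestSet` as a finset. -/
noncomputable def forests (k m : ℕ) : Finset (List (BinaryTree Unit)) :=
  (forestSet_finite k m).toFinset

theorem mem_forests {k m : ℕ} {L : List (BinaryTree Unit)} :
    L ∈ forests k m ↔ leafCount L = m ∧ ∀ T ∈ L, T.height ≤ k := by
  rw [forests, Set.Finite.mem_toFinset]; rfl

theorem card_forests_zero (k : ℕ) : (forests k 0).card = 1 := by
  rw [Finset.card_eq_one]
  refine ⟨[], ?_⟩
  ext L
  rw [mem_forests, Finset.mem_singleton]
  constructor
  · rintro ⟨h, -⟩
    cases L with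
    | nil => rfl
    | cons T L =>
      have := T.numLeaves_pos
      rw [leafCount_cons] at h
      omega
  · rintro rfl
    simp

/-- Split off the first tree; `0 < m` guarantees that there is one. -/
theorem card_forests_recurrence {k m : ℕ} (hm : 0 < m) : (forests k m).card =
    ∑ T ∈ treesOfHeightLE k with T.numLeaves ≤ m, (forests k (m - T.numLeaves)).card := by
  have h : forests k m = ((treesOfHeightLE k).filter fun T => T.numLeaves ≤ m).biUnion
      fun T => (forests k (m - T.numLeaves)).image (T :: ·) := by
    ext L
    simp only [Finset.mem_biUnion, Finset.mem_filter, Finset.mem_image, mem_forests,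
      mem_treesOfHeightLE]
    constructor
    · rintro ⟨h1, h2⟩
      cases L with
      | nil => simp at h1; omega
      | cons T L =>
        rw [leafCount_cons] at h1
        exact ⟨T, ⟨h2 T (by simp), by omega⟩, L, ⟨by omega, fun U hU => h2 U (by simp [hU])⟩, rfl⟩
    · rintro ⟨T, ⟨h1, h2⟩, L, ⟨h3, h4⟩, rfl⟩
      exact ⟨by rw [leafCount_cons]; omega, by simpa using ⟨h1, h4⟩⟩
  rw [h, Finset.card_biUnion]
  · refine Finset.sum_congr rfl fun T _ => Finset.card_image_of_injective _ fun L L' h => ?_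
    simpa using h
  · intro T _ U _ hTU
    rw [Function.onFun, Finset.disjoint_left]
    intro L h1 h2
    simp only [Finset.mem_image] at h1 h2
    obtain ⟨A, -, rfl⟩ := h1
    obtain ⟨B, -, h⟩ := h2
    simp at h
    exact hTU h.1.symm

/-- The pairs of lists of trees of height at most `k` with `m` leaves altogether. -/
noncomputable def forestPairs (k m : ℕ) :
    Finset (List (BinaryTree Unit) × List (BinaryTree Unit)) :=
  (Finset.HasAntidiagonal.antidiagonal m).biUnion fun q => forests k q.1 ×ˢ forests k q.2

theorem mem_forestPairs {k m : ℕ} {z : List (BinaryTree Unit) × List (BinaryTree Unit)} :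
    z ∈ forestPairs k m ↔ leafCount z.1 + leafCount z.2 = m ∧
      (∀ T ∈ z.1, T.height ≤ k) ∧ ∀ T ∈ z.2, T.height ≤ k := by
  simp only [forestPairs, Finset.mem_biUnion, Finset.mem_product, mem_forests,
    Finset.HasAntidiagonal.mem_antidiagonal]
  constructor
  · rintro ⟨q, h, ⟨h1, h2⟩, h3, h4⟩
    exact ⟨by omega, h2, h4⟩
  · rintro ⟨h, h1, h2⟩
    exact ⟨(_, _), h, ⟨rfl, h1⟩, rfl, h2⟩

theorem card_forestPairs (k m : ℕ) : (forestPairs k m).card =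
    ∑ q ∈ Finset.HasAntidiagonal.antidiagonal m, (forests k q.1).card * (forests k q.2).card := by
  rw [forestPairs, Finset.card_biUnion]
  · exact Finset.sum_congr rfl fun q _ => Finset.card_product _ _
  · intro q _ q' _ hq
    rw [Function.onFun, Finset.disjoint_left]
    intro z h1 h2
    simp only [Finset.mem_product, mem_forests] at h1 h2
    exact hq (Prod.ext (h1.1.1.symm.trans h2.1.1) (h1.2.1.symm.trans h2.2.1))

theorem zipSet_eq (n k : ℕ) : zipSet n k =
    ↑(forestPairs k (n + 1) \ (forests k (n + 1)).image fun L => (L, [])) := by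
  ext ⟨ls, rs⟩
  simp only [zipSet, Set.mem_ofPred_eq, Finset.coe_sdiff, Set.mem_sdiff, Finset.mem_coe,
    mem_forestPairs, Finset.mem_image, mem_forests, not_exists, not_and]
  constructor
  · rintro ⟨h1, h2, h3, h4⟩
    refine ⟨⟨h2, h3, h4⟩, fun L _ h => h1 ?_⟩
    exact (Prod.ext_iff.1 h).2.symm
  · rintro ⟨⟨h2, h3, h4⟩, h⟩
    refine ⟨?_, h2, h3, h4⟩
    rintro rfl
    exact h ls ⟨by simpa using h2, h3⟩ rfl

theorem ncard_zipSet (n k : ℕ) :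
    (zipSet n k).ncard + (forests k (n + 1)).card = (forestPairs k (n + 1)).card := by
  have hinj : Function.Injective
      (fun L : List (BinaryTree Unit) => (L, ([] : List (BinaryTree Unit)))) :=
    fun L L' h => (Prod.ext_iff.1 h).1
  rw [zipSet_eq, Set.ncard_coe_finset, ← Finset.card_image_of_injective (forests k (n + 1)) hinj]
  refine Finset.card_sdiff_add_card_eq_card ?_
  intro z hz
  simp only [Finset.mem_image, mem_forests] at hz
  obtain ⟨L, ⟨h1, h2⟩, rfl⟩ := hz
  rw [mem_forestPairs]
  exact ⟨by simpa using h1, h2, by simp⟩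

/-- Placing the lone tree in front of the left list gives an arbitrary list with `n + 1` leaves. -/
theorem ncard_zipSet_singleton (n k : ℕ) :
    {z ∈ zipSet n k | ∃ r, z.2 = [r]}.ncard = (forests k (n + 1)).card := by
  have : {z ∈ zipSet n k | ∃ r, z.2 = [r]} =
      (fun L : List (BinaryTree Unit) => (L.tail, L.take 1)) '' (forests k (n + 1)) := by
    ext ⟨ls, rs⟩
    simp only [zipSet, Set.mem_ofPred_eq, Set.mem_image, Finset.mem_coe, mem_forests]
    constructor
    · rintro ⟨⟨-, h2, h3, h4⟩, r, rfl⟩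
      refine ⟨r :: ls, ⟨?_, ?_⟩, rfl⟩
      · simp at h2 ⊢; omega
      · simpa using ⟨by simpa using h4, h3⟩
    · rintro ⟨L, ⟨h1, h2⟩, h⟩
      cases L with
      | nil => simp at h1
      | cons r L =>
        simp at h
        obtain ⟨rfl, rfl⟩ := h
        simp at h1 h2
        refine ⟨⟨by simp, ?_, h2.2, by simpa using h2.1⟩, r, rfl⟩
        simp
        omega
  rw [this, Set.ncard_image_of_injective, Set.ncard_coe_finset]
  intro L L' h
  have h' := Prod.ext_iff.1 h
  rw [← List.take_append_drop 1 L, ← List.take_append_drop 1 L', List.drop_one, List.drop_one]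
  exact congrArg₂ _ h'.2 h'.1

/-- Deleting the trivial tree at the pointer gives an arbitrary pair with `n` leaves; the right list
may become empty, so no pairs are excluded. -/
theorem ncard_zipSet_trivial (n k : ℕ) :
    {z ∈ zipSet n k | ∃ rs, z.2 = .nil :: rs}.ncard = (forestPairs k n).card := by
  have : {z ∈ zipSet n k | ∃ rs, z.2 = .nil :: rs} =
      (fun z : List (BinaryTree Unit) × List (BinaryTree Unit) => (z.1, .nil :: z.2)) ''
        (forestPairs k n) := by
    ext ⟨ls, rs⟩
    simp only [zipSet, Set.mem_ofPred_eq, Set.mem_image, Finset.mem_coe, mem_forestPairs]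
    constructor
    · rintro ⟨⟨-, h2, h3, h4⟩, r, rfl⟩
      refine ⟨(ls, r), ⟨?_, h3, ?_⟩, rfl⟩
      · simp [BinaryTree.numLeaves] at h2 ⊢; omega
      · simpa [BinaryTree.height] using h4
    · rintro ⟨⟨ls', rs'⟩, ⟨h1, h2, h3⟩, h⟩
      simp at h h1 h2 h3
      obtain ⟨rfl, rfl⟩ := h
      refine ⟨⟨by simp, ?_, h2, ?_⟩, rs', rfl⟩
      · simp [BinaryTree.numLeaves]; omega
      · simpa [BinaryTree.height] using h3
  rw [this, Set.ncard_image_of_injective, Set.ncard_coe_finset]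
  rintro ⟨a, b⟩ ⟨c, d⟩ h
  simpa using h

/-! ## The cardinalities of `S n k` and of its boundary -/

/-- The element realizing a zipper. -/
noncomputable def zipElt (z : List (BinaryTree Unit) × List (BinaryTree Unit)) : F :=
  (exists_realizes z.1 z.2).choose

theorem zipElt_realizes (z : List (BinaryTree Unit) × List (BinaryTree Unit)) :
    Realizes z.1 z.2 (zipElt z) := (exists_realizes z.1 z.2).choose_spec

theorem S_eq_image (n k : ℕ) : S n k = zipElt '' zipSet n k := by
  ext f
  rw [mem_S_iff]
  constructor
  · rintro ⟨z, hz, hf⟩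
    exact ⟨z, hz, (zipElt_realizes z).unique hf⟩
  · rintro ⟨z, hz, rfl⟩
    exact ⟨z, hz, zipElt_realizes z⟩

/-- Fixing the total at `n + 1` removes the ambiguity of trailing trivial trees. -/
theorem zipElt_injOn (n k : ℕ) : Set.InjOn zipElt (zipSet n k) := by
  intro z hz z' hz' h
  have h1 := zipElt_realizes z
  rw [h] at h1
  have := eq_of_zipCoord_eq (h1.zipCoord_eq (zipElt_realizes z'))
    (hz.2.1.trans hz'.2.1.symm)
  exact Prod.ext this.1 this.2

theorem zipSet_finite (n k : ℕ) : (zipSet n k).Finite := by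
  rw [zipSet_eq]; exact Finset.finite_toSet _

theorem S_finite (n k : ℕ) : (S n k).Finite := by
  rw [S_eq_image]; exact (zipSet_finite n k).image _

theorem S_nonempty (n k : ℕ) : (S n k).Nonempty := by
  rw [S_eq_image]
  refine Set.Nonempty.image _ ⟨([], List.replicate (n + 1) .nil), by simp, ?_, by simp, ?_⟩
  · simp [leafCount, BinaryTree.numLeaves]
  · intro T hT
    rw [List.eq_of_mem_replicate hT]
    exact Nat.zero_le k

theorem ncard_S (n k : ℕ) : (S n k).ncard = (zipSet n k).ncard := by
  rw [S_eq_image, (zipElt_injOn n k).ncard_image]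

theorem leafCount_eq_of_realizes {ls rs ls' rs' : List (BinaryTree Unit)} {f : F}
    (h : Realizes ls rs f) (h' : Realizes ls' rs' f) : leafCount ls = leafCount ls' := by
  have := h.zipCoord_eq h' 0
  rw [zipCoord_zero, zipCoord_zero] at this
  exact_mod_cast this

/-- The pointer cannot move right within the allotted leaves exactly when it is at the last tree. -/
theorem ncard_S_mul_x0 (n k : ℕ) :
    {f ∈ S n k | f * x0 ∉ S n k}.ncard = (forests k (n + 1)).card := by
  rw [← ncard_zipSet_singleton, ←
    ((zipElt_injOn n k).mono (Set.sep_subset _ _)).ncard_image]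
  congr 1
  ext f
  constructor
  · rintro ⟨hf, hn⟩
    obtain ⟨⟨ls, rs⟩, hz, h⟩ := mem_S_iff.1 hf
    refine ⟨(ls, rs), ⟨hz, ?_⟩, (zipElt_realizes _).unique h⟩
    obtain ⟨h1, h2, h3, h4⟩ := hz
    match rs, h1, h2, h3, h4, h with
    | [r], _, _, _, _, _ => exact ⟨r, rfl⟩
    | r :: r' :: rs, _, h2, h3, h4, h =>
      refine absurd (mem_S_iff.2 ⟨(r :: ls, r' :: rs), ⟨by simp, ?_, ?_, ?_⟩,
        realizes_mul_x0_iff.2 h⟩) hn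
      · simp at h2 ⊢; omega
      · simp at h4 ⊢; exact ⟨h4.1, h3⟩
      · simp at h4 ⊢; exact h4.2
  · rintro ⟨⟨ls, rs⟩, ⟨hz, r, hr⟩, rfl⟩
    simp only at hr
    subst hr
    have hf : Realizes ls [r] _ := zipElt_realizes (ls, [r])
    refine ⟨mem_S_iff.2 ⟨_, hz, hf⟩, fun hS => ?_⟩
    obtain ⟨z, hz', h⟩ := mem_S_iff.1 hS
    -- After the move all `n + 1` leaves lie left of the pointer, leaving none for the nonempty
    -- right list of `z`.
    have h1 := leafCount_eq_of_realizes (realizes_mul_x0_iff.2 hf) h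
    have h2 := hz.2.1
    obtain ⟨h3, h4, -⟩ := hz'
    rw [leafCount_cons] at h1
    simp at h2
    obtain ⟨T, L, hTL⟩ := List.exists_cons_of_ne_nil h3
    rw [hTL, leafCount_cons] at h4
    have := T.numLeaves_pos
    omega

/-- Removing the root caret at the pointer preserves the number of leaves and the height bound, so
only a trivial tree obstructs it. -/
theorem ncard_S_mul_x1_inv (n k : ℕ) :
    {f ∈ S n k | f * x1⁻¹ ∉ S n k}.ncard = (forestPairs k n).card := by
  rw [← ncard_zipSet_trivial, ←
    ((zipElt_injOn n k).mono (Set.sep_subset _ _)).ncard_image]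
  congr 1
  ext f
  constructor
  · rintro ⟨hf, hn⟩
    obtain ⟨⟨ls, rs⟩, hz, h⟩ := mem_S_iff.1 hf
    refine ⟨(ls, rs), ⟨hz, ?_⟩, (zipElt_realizes _).unique h⟩
    obtain ⟨h1, h2, h3, h4⟩ := hz
    match rs, h1, h2, h3, h4, h with
    | .nil :: rs, _, _, _, _, _ => exact ⟨rs, rfl⟩
    | .node () a b :: rs, _, h2, h3, h4, h =>
      refine absurd (mem_S_iff.2 ⟨(ls, a :: b :: rs), ⟨by simp, ?_, h3, ?_⟩, h.mul_x1_inv⟩) hn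
      · simp [BinaryTree.numLeaves] at h2 ⊢; omega
      · simp [BinaryTree.height] at h4 ⊢
        exact ⟨by omega, by omega, h4.2⟩
  · rintro ⟨⟨ls, rs⟩, ⟨hz, L, hr⟩, rfl⟩
    simp only at hr
    subst hr
    have hf : Realizes ls (.nil :: L) _ := zipElt_realizes (ls, .nil :: L)
    refine ⟨mem_S_iff.2 ⟨_, hz, hf⟩, fun hS => ?_⟩
    obtain ⟨⟨ls', rs'⟩, ⟨h1, -⟩, h⟩ := mem_S_iff.1 hS
    -- Padding by a trivial tree ensures two trees at the pointer; multiplying back by `x1` would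
    -- then put a caret where `f` has a trivial tree.
    have : ∃ a b rs'', Realizes ls' (a :: b :: rs'') (zipElt (ls, .nil :: L) * x1⁻¹) := by
      match rs', h1, h with
      | [r], _, h => exact ⟨r, .nil, [], h.congr (zipCoord_append_nil ls' [r])⟩
      | a :: b :: rs'', _, h => exact ⟨a, b, rs'', h⟩
    obtain ⟨a, b, rs'', h2⟩ := this
    have h3 := h2.mul_x1
    rw [inv_mul_cancel_right] at h3
    have h4 := zipTree_eq_of_zipCoord_eq (h3.zipCoord_eq hf) 0
    exact BinaryTree.noConfusion rfl (heq_of_eq h4)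

theorem coe_apply_ne {f g : F} {x : unitInterval}
    (h : ((f : unitInterval ≃o unitInterval) x : ℝ) ≠ (g : unitInterval ≃o unitInterval) x) :
    f ≠ g := fun e => h (by rw [e])

theorem ncard_edgeBoundary_S (n k : ℕ) : (edgeBoundary ({x0, x1} : Set F) (S n k)).ncard =
    2 * (forests k (n + 1)).card + 2 * (forestPairs k n).card := by
  have one_apply : ∀ x : unitInterval, ((1 : F) : unitInterval ≃o unitInterval) x = x :=
    fun _ => rfl
  rw [ncard_edgeBoundary ?_ ?_ ?_ ?_ (S_finite n k), ncard_S_mul_x0, ncard_S_mul_x1_inv]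
  · apply coe_apply_ne (x := ⟨1 / 2, by norm_num, by norm_num⟩)
    rw [mul_coe_apply, x0_apply, x0_apply, one_apply]
    norm_num [x0Fun]
  · apply coe_apply_ne (x := ⟨3 / 4, by norm_num, by norm_num⟩)
    rw [mul_coe_apply, x1_apply, x1_apply, one_apply]
    norm_num [x1Fun]
  · apply coe_apply_ne (x := ⟨1 / 2, by norm_num, by norm_num⟩)
    rw [x0_apply, x1_apply]
    norm_num [x0Fun, x1Fun]
  · apply coe_apply_ne (x := ⟨1 / 2, by norm_num, by norm_num⟩)
    rw [mul_coe_apply, x0_apply, x1_apply, one_apply]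
    norm_num [x0Fun, x1Fun]

end Thompson

/-! ## The renewal theorem for finitely many step lengths -/

section Renewal

variable {ι : Type*} {s : Finset ι} {l : ι → ℕ} {w : ι → ℝ} {u : ℕ → ℝ} {K : ℕ}

theorem renewal_nonneg_le_one (hl : ∀ i ∈ s, 1 ≤ l i) (hw : ∀ i ∈ s, 0 ≤ w i)
    (hsum : ∑ i ∈ s, w i = 1) (h0 : u 0 = 1)
    (hu : ∀ n, 0 < n → u n = ∑ i ∈ s with l i ≤ n, w i * u (n - l i)) (n : ℕ) :
    0 ≤ u n ∧ u n ≤ 1 := by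
  induction n using Nat.strong_induction_on with
  | _ n ih =>
    rcases Nat.eq_zero_or_pos n with rfl | hn
    · simp [h0]
    · have h1 : ∀ i ∈ s.filter fun i => l i ≤ n, 0 ≤ u (n - l i) ∧ u (n - l i) ≤ 1 := by
        intro i hi
        have := hl i (Finset.mem_filter.1 hi).1
        exact ih _ (by omega)
      rw [hu n hn]
      constructor
      · exact Finset.sum_nonneg fun i hi =>
          mul_nonneg (hw i (Finset.mem_filter.1 hi).1) (h1 i hi).1
      · calc ∑ i ∈ s with l i ≤ n, w i * u (n - l i) ≤ ∑ i ∈ s with l i ≤ n, w i :=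
              Finset.sum_le_sum fun i hi =>
                mul_le_of_le_one_right (hw i (Finset.mem_filter.1 hi).1) (h1 i hi).2
          _ ≤ ∑ i ∈ s, w i := Finset.sum_le_sum_of_subset_of_nonneg (Finset.filter_subset _ _)
              fun i hi _ => hw i hi
          _ = 1 := hsum

theorem renewal_eq_sum (hK : ∀ i ∈ s, l i ≤ K) (hl : ∀ i ∈ s, 1 ≤ l i) (hsum : ∑ i ∈ s, w i = 1)
    (hu : ∀ n, 0 < n → u n = ∑ i ∈ s with l i ≤ n, w i * u (n - l i)) {n : ℕ} (hn : K ≤ n) :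
    u n = ∑ i ∈ s, w i * u (n - l i) := by
  obtain ⟨i, hi⟩ : s.Nonempty := by
    rw [Finset.nonempty_iff_ne_empty]
    rintro rfl
    simp at hsum
  have h1 := hK i hi
  have h2 := hl i hi
  rw [hu n (by omega), Finset.filter_true_of_mem fun i hi => (hK i hi).trans hn]

/-- A lower bound on a window of length `K` persists. -/
theorem renewal_lower_bound (hK : ∀ i ∈ s, l i ≤ K) (hl : ∀ i ∈ s, 1 ≤ l i)
    (hw : ∀ i ∈ s, 0 ≤ w i) (hsum : ∑ i ∈ s, w i = 1)
    (hu : ∀ n, 0 < n → u n = ∑ i ∈ s with l i ≤ n, w i * u (n - l i)) {n : ℕ} {c : ℝ}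
    (hc : ∀ j, n ≤ j → j < n + K → c ≤ u j) (m : ℕ) (hm : n ≤ m) : c ≤ u m := by
  induction m using Nat.strong_induction_on with
  | _ m ih =>
    rcases lt_or_ge m (n + K) with h | h
    · exact hc m hm h
    · rw [renewal_eq_sum hK hl hsum hu (by omega : K ≤ m)]
      calc c = ∑ i ∈ s, w i * c := by rw [← Finset.sum_mul, hsum, one_mul]
        _ ≤ _ := Finset.sum_le_sum fun i hi => by
          have h1 := hK i hi
          have h2 := hl i hi
          exact mul_le_mul_of_nonneg_left (ih _ (by omega) (by omega)) (hw i hi)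

/-- The contribution of `n` successive steps of length one. -/
theorem renewal_pow_le (hl : ∀ i ∈ s, 1 ≤ l i) (hw : ∀ i ∈ s, 0 ≤ w i)
    (hsum : ∑ i ∈ s, w i = 1) (h0 : u 0 = 1)
    (hu : ∀ n, 0 < n → u n = ∑ i ∈ s with l i ≤ n, w i * u (n - l i)) {a : ι} (ha : a ∈ s)
    (hla : l a = 1) (n : ℕ) : w a ^ n ≤ u n := by
  induction n with
  | zero => simp [h0]
  | succ n ih =>
    have hb := renewal_nonneg_le_one hl hw hsum h0 hu
    rw [hu (n + 1) (Nat.succ_pos n), pow_succ']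
    refine (mul_le_mul_of_nonneg_left ih (hw a ha)).trans ?_
    have := Finset.single_le_sum (f := fun i => w i * u (n + 1 - l i))
      (s := s.filter fun i => l i ≤ n + 1)
      (fun i hi => mul_nonneg (hw i (Finset.mem_filter.1 hi).1) (hb _).1)
      (Finset.mem_filter.2 ⟨ha, by omega⟩)
    simpa only [hla, Nat.add_sub_cancel] using this

/-- The renewal theorem: if one of the steps has length `1` and positive weight, then the renewal
sequence is bounded below by a positive constant and converges. -/
theorem renewal_tendsto (hK : ∀ i ∈ s, l i ≤ K) (hl : ∀ i ∈ s, 1 ≤ l i)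
    (hw : ∀ i ∈ s, 0 ≤ w i) (hsum : ∑ i ∈ s, w i = 1) (h0 : u 0 = 1)
    (hu : ∀ n, 0 < n → u n = ∑ i ∈ s with l i ≤ n, w i * u (n - l i)) {a : ι} (ha : a ∈ s)
    (hla : l a = 1) (hwa : 0 < w a) :
    (∃ c > 0, ∀ n, c ≤ u n) ∧ ∃ L, Tendsto u atTop (𝓝 L) := by
  classical
  have hb := renewal_nonneg_le_one hl hw hsum h0 hu
  have hwa1 : w a ≤ 1 := hsum ▸ Finset.single_le_sum hw ha
  constructor
  · refine ⟨w a ^ K, pow_pos hwa K, fun n => ?_⟩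
    refine renewal_lower_bound hK hl hw hsum hu (n := 0) (fun j _ hj => ?_) n (Nat.zero_le n)
    exact (pow_le_pow_of_le_one hwa.le hwa1 (by omega)).trans
      (renewal_pow_le hl hw hsum h0 hu ha hla j)
  · set L := limsup u atTop with hL
    have bdd : IsBoundedUnder (· ≤ ·) atTop u := isBoundedUnder_of ⟨1, fun n => (hb n).2⟩
    have bdd' : IsBoundedUnder (· ≥ ·) atTop u := isBoundedUnder_of ⟨0, fun n => (hb n).1⟩
    refine ⟨L, Metric.tendsto_atTop.2 fun ε hε => ?_⟩
    have hq : 1 ≤ 2 / w a := by rw [le_div_iff₀ hwa]; linarith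
    have hqK : 1 ≤ (2 / w a) ^ K := one_le_pow₀ hq
    -- Each backward step multiplies the error by `2 / w a`; after `K` of them it is still at most
    -- `ε / 2`.
    set δ := ε / 2 / (2 / w a) ^ K with hδ
    have hδ0 : 0 < δ := by positivity
    have hδε : (2 / w a) ^ K * δ = ε / 2 := by rw [hδ]; field_simp
    obtain ⟨N, hN⟩ := eventually_atTop.1
      (eventually_lt_of_limsup_lt (show limsup u atTop < L + δ by rw [← hL]; linarith) bdd)
    -- The margin `2 * K` keeps every index met in `K` backward steps, each looking back by at most
    -- `K`, beyond `N`.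
    obtain ⟨n, hn, hun⟩ := frequently_atTop.1
      (frequently_lt_of_lt_limsup bdd'.isCoboundedUnder_le
        (show L - δ < limsup u atTop by rw [← hL]; linarith)) (N + 2 * K + 1)
    -- `u (n - j)` is a weighted mean near the limsup whose other terms are below `L + δ`, so the
    -- term of positive weight `w a`, one step back, cannot be much lower.
    have back : ∀ j, j ≤ K → L - (2 / w a) ^ j * δ ≤ u (n - j) := by
      intro j
      induction j with
      | zero => intro _; simpa using hun.le
      | succ j ih =>
        intro hj
        have h1 := ih (by omega)
        have hD : δ ≤ (2 / w a) ^ j * δ := le_mul_of_one_le_left hδ0.le (one_le_pow₀ hq)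
        set D := (2 / w a) ^ j * δ with hDdef
        rw [renewal_eq_sum hK hl hsum hu (by omega : K ≤ n - j),
          ← Finset.add_sum_erase s _ ha, hla] at h1
        have h2 : ∑ i ∈ s.erase a, w i * u (n - j - l i) ≤ ∑ i ∈ s.erase a, w i * (L + δ) :=
          Finset.sum_le_sum fun i hi => by
            have h3 := Finset.mem_of_mem_erase hi
            have := hK i h3
            exact mul_le_mul_of_nonneg_left (hN _ (by omega)).le (hw i h3)
        rw [← Finset.sum_mul] at h2
        have h4 : ∑ i ∈ s.erase a, w i = 1 - w a := by
          rw [← hsum, ← Finset.add_sum_erase s _ ha]; ring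
        rw [h4] at h2
        rw [show n - j - 1 = n - (j + 1) by omega] at h1
        have h5 : w a * (L - 2 / w a * D) ≤ w a * u (n - (j + 1)) := by
          have : w a * (2 / w a * D) = 2 * D := by field_simp
          rw [mul_sub, this]
          nlinarith
        have := le_of_mul_le_mul_left h5 hwa
        rwa [hDdef, ← mul_assoc, ← pow_succ'] at this
    -- The backward steps fill a window of length `K`, and a lower bound on such a window persists.
    have low : ∀ m, n - K ≤ m → L - ε / 2 ≤ u m := by
      refine renewal_lower_bound hK hl hw hsum hu fun j hj hj' => ?_
      have h1 := back (n - j) (by omega)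
      rw [show n - (n - j) = j by omega] at h1
      have h2 : (2 / w a) ^ (n - j) * δ ≤ (2 / w a) ^ K * δ :=
        mul_le_mul_of_nonneg_right (pow_le_pow_right₀ hq (by omega)) hδ0.le
      linarith
    refine ⟨n, fun m hm => ?_⟩
    have h1 := low m (by omega)
    have h2 := hN m (by omega)
    have h3 : δ ≤ ε / 2 := by
      rw [← hδε]; exact le_mul_of_one_le_left hδ0.le hqK
    rw [Real.dist_eq, abs_lt]
    constructor <;> linarith

end Renewal

/-! ## Ratios of a self-convolution -/

theorem convolution_sub (u : ℕ → ℝ) (n : ℕ) :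
    ∑ q ∈ Finset.HasAntidiagonal.antidiagonal (n + 1), u q.1 * u q.2 -
      ∑ q ∈ Finset.HasAntidiagonal.antidiagonal n, u q.1 * u q.2 =
    ∑ q ∈ Finset.HasAntidiagonal.antidiagonal n, u q.1 * (u (q.2 + 1) - u q.2) + u (n + 1) * u 0 := by
  rw [Finset.Nat.antidiagonal_succ', Finset.sum_cons, Finset.sum_map]
  simp only [Function.Embedding.prodMap, Function.Embedding.coeFn_mk, Prod.map,
    Function.Embedding.refl_apply, mul_sub, Finset.sum_sub_distrib, Nat.succ_eq_add_one]
  ring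

theorem abs_convolution_sub_le {u : ℕ → ℝ} (hu : ∀ n, 0 ≤ u n ∧ u n ≤ 1) (n : ℕ) :
    |∑ q ∈ Finset.HasAntidiagonal.antidiagonal (n + 1), u q.1 * u q.2 -
      ∑ q ∈ Finset.HasAntidiagonal.antidiagonal n, u q.1 * u q.2| ≤
    ∑ i ∈ Finset.range (n + 1), |u (i + 1) - u i| + 1 := by
  rw [convolution_sub]
  refine (abs_add_le _ _).trans (add_le_add ?_ ?_)
  · refine (Finset.abs_sum_le_sum_abs _ _).trans ?_
    have e : ∑ i ∈ Finset.range (n + 1), |u (i + 1) - u i| =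
        ∑ q ∈ Finset.HasAntidiagonal.antidiagonal n, |u (q.2 + 1) - u q.2| := by
      rw [Finset.Nat.sum_antidiagonal_eq_sum_range_succ_mk,
        ← Finset.sum_range_reflect]
      exact Finset.sum_congr rfl fun i hi => by
        have := Finset.mem_range.1 hi
        rw [show n + 1 - 1 - i = n - i by omega]
    rw [e]
    refine Finset.sum_le_sum fun q _ => ?_
    rw [abs_mul, abs_of_nonneg (hu _).1]
    exact mul_le_of_le_one_left (abs_nonneg _) (hu _).2
  · rw [abs_of_nonneg (mul_nonneg (hu _).1 (hu _).1)]
    exact mul_le_one₀ (hu _).2 (hu _).1 (hu _).2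

theorem le_convolution {u : ℕ → ℝ} {c : ℝ} (hc : 0 < c) (hu : ∀ n, c ≤ u n) (n : ℕ) :
    c ^ 2 * (n + 1) ≤ ∑ q ∈ Finset.HasAntidiagonal.antidiagonal n, u q.1 * u q.2 := by
  have : ∑ q ∈ Finset.HasAntidiagonal.antidiagonal n, c * c ≤ ∑ q ∈ Finset.HasAntidiagonal.antidiagonal n, u q.1 * u q.2 :=
    Finset.sum_le_sum fun q _ => mul_le_mul (hu _) (hu _) hc.le (hc.le.trans (hu _))
  rw [Finset.sum_const, Finset.Nat.card_antidiagonal, nsmul_eq_mul] at this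
  push_cast at this
  linarith

/-- The increments of `u` tend to `0`, so their Cesàro means do too; this makes the increments of
the convolution `o(n)`, against its linear lower bound. The value of `L` plays no role. -/
theorem convolution_ratio_tendsto {u : ℕ → ℝ} (hu : ∀ n, 0 ≤ u n ∧ u n ≤ 1) {c : ℝ} (hc : 0 < c)
    (hcu : ∀ n, c ≤ u n) {L : ℝ} (hL : Tendsto u atTop (𝓝 L)) :
    Tendsto (fun n => (∑ q ∈ Finset.HasAntidiagonal.antidiagonal (n + 1), u q.1 * u q.2) /
      ∑ q ∈ Finset.HasAntidiagonal.antidiagonal n, u q.1 * u q.2) atTop (𝓝 1) := by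
  set v : ℕ → ℝ := fun n => ∑ q ∈ Finset.HasAntidiagonal.antidiagonal n, u q.1 * u q.2 with hv
  have hvl : ∀ n, c ^ 2 * (n + 1) ≤ v n := le_convolution hc hcu
  have hv0 : ∀ n, 0 < v n := fun n => lt_of_lt_of_le (by positivity) (hvl n)
  have hd : Tendsto (fun n => |u (n + 1) - u n|) atTop (𝓝 0) := by
    have := ((hL.comp (tendsto_add_atTop_nat 1)).sub hL).abs
    simpa using this
  have hces := (hd.cesaro.comp (tendsto_add_atTop_nat 1)).add
    (tendsto_one_div_add_atTop_nhds_zero_nat (𝕜 := ℝ))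
  rw [add_zero] at hces
  have hbound := hces.const_mul (1 / c ^ 2)
  rw [mul_zero] at hbound
  rw [tendsto_iff_norm_sub_tendsto_zero]
  refine squeeze_zero (fun _ => norm_nonneg _) (fun n => ?_) hbound
  have h1 := abs_convolution_sub_le hu n
  have h2 : v (n + 1) / v n - 1 = (v (n + 1) - v n) / v n := by
    field_simp [(hv0 n).ne']
  rw [Real.norm_eq_abs, show (∑ q ∈ Finset.HasAntidiagonal.antidiagonal (n + 1), u q.1 * u q.2) /
    (∑ q ∈ Finset.HasAntidiagonal.antidiagonal n, u q.1 * u q.2) = v (n + 1) / v n from rfl, h2, abs_div,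
    abs_of_pos (hv0 n)]
  calc |v (n + 1) - v n| / v n
      ≤ (∑ i ∈ Finset.range (n + 1), |u (i + 1) - u i| + 1) / (c ^ 2 * (n + 1)) :=
        div_le_div₀ ((abs_nonneg _).trans h1) h1 (by positivity) (hvl n)
    _ = _ := by
        simp only [Function.comp]
        push_cast
        field_simp

/-! ## The limit of the boundary ratio and the roots `p_k` -/

namespace Thompson

theorem boundaryRatio_S_tendsto {k : ℕ} {p : ℝ} (hp : 0 < p) (h : treePoly k p = 1) :
    Tendsto (fun n => boundaryRatio ({x0, x1} : Set F) (S n k)) atTop (𝓝 (2 * p)) := by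
  set u : ℕ → ℝ := fun n => (forests k n).card * p ^ n with hu
  set v : ℕ → ℝ := fun n => ∑ q ∈ Finset.HasAntidiagonal.antidiagonal n, u q.1 * u q.2 with hv
  have hl : ∀ T ∈ treesOfHeightLE k, 1 ≤ T.numLeaves := fun T _ => T.numLeaves_pos
  have hw : ∀ T ∈ treesOfHeightLE k, 0 ≤ p ^ T.numLeaves := fun T _ => by positivity
  have hsum : ∑ T ∈ treesOfHeightLE k, p ^ T.numLeaves = 1 := by rw [← treePoly_eq_sum, h]
  have h0 : u 0 = 1 := by simp [hu, card_forests_zero]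
  have hrec : ∀ n, 0 < n → u n = ∑ T ∈ treesOfHeightLE k with T.numLeaves ≤ n,
      p ^ T.numLeaves * u (n - T.numLeaves) := by
    intro n hn
    simp only [hu]
    rw [card_forests_recurrence hn, Nat.cast_sum, Finset.sum_mul]
    refine Finset.sum_congr rfl fun T hT => ?_
    rw [← Nat.sub_add_cancel (Finset.mem_filter.1 hT).2, pow_add, Nat.add_sub_cancel]
    ring
  have hb := renewal_nonneg_le_one hl hw hsum h0 hrec
  obtain ⟨⟨c, hc, hcu⟩, L, hL⟩ := renewal_tendsto (fun T hT => numLeaves_le_of_mem hT) hl hw hsum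
    h0 hrec (a := .nil) (mem_treesOfHeightLE.2 (Nat.zero_le k)) rfl (by positivity)
  have hratio : Tendsto (fun n => v (n + 1) / v n) atTop (𝓝 1) :=
    convolution_ratio_tendsto hb hc hcu hL
  have hvl : ∀ n, c ^ 2 * (n + 1) ≤ v n := le_convolution hc hcu
  have hv0 : ∀ n, 0 < v n := fun n => lt_of_lt_of_le (by positivity) (hvl n)
  have hsmall : Tendsto (fun n => u (n + 1) / v n) atTop (𝓝 0) := by
    have := (tendsto_one_div_add_atTop_nhds_zero_nat (𝕜 := ℝ)).const_mul (1 / c ^ 2)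
    rw [mul_zero] at this
    refine squeeze_zero (fun n => div_nonneg (hb _).1 (hv0 n).le) (fun n => ?_) this
    rw [one_div_mul_one_div]
    exact div_le_div₀ zero_le_one (hb _).2 (by positivity) (hvl n)
  -- Numerator and denominator of the boundary ratio, both multiplied by `p ^ (n+1)` and divided by
  -- `v n`.
  have hlim := ((hsmall.const_mul 2).add_const (2 * p)).div (hratio.sub hsmall) (by norm_num)
  rw [mul_zero, zero_add, sub_zero, div_one] at hlim
  have hvp : ∀ n, v n = (forestPairs k n).card * p ^ n := by
    intro n
    rw [card_forestPairs, Nat.cast_sum, Finset.sum_mul]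
    refine Finset.sum_congr rfl fun q hq => ?_
    rw [← Finset.HasAntidiagonal.mem_antidiagonal.1 hq, pow_add]
    simp only [hu]
    push_cast; ring
  refine hlim.congr fun n => ?_
  have hcard : ((S n k).ncard : ℝ) = (forestPairs k (n + 1)).card - (forests k (n + 1)).card := by
    rw [ncard_S, ← ncard_zipSet]
    push_cast; ring
  have hpn : p ^ (n + 1) ≠ 0 := by positivity
  rw [boundaryRatio, ncard_edgeBoundary_S, hcard]
  simp only [Pi.div_apply]
  rw [← sub_div, ← mul_div_mul_right _ _ (hv0 n).ne', ← mul_div_mul_right (_ : ℝ) (_ - _ : ℝ) hpn]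
  congr 1
  · rw [add_mul, mul_assoc, div_mul_cancel₀ _ (hv0 n).ne', hvp n]
    simp only [hu]
    push_cast; ring
  · rw [div_mul_cancel₀ _ (hv0 n).ne', hvp]
    simp only [hu]
    ring

/-! ### The roots of `t_k(p) = 1` and their limit. -/

theorem treePoly_strictMonoOn (k : ℕ) : StrictMonoOn (treePoly k) (Set.Ici 0) := by
  intro p hp q hq h
  rw [treePoly_eq_sum, treePoly_eq_sum]
  refine Finset.sum_lt_sum (fun T _ => pow_le_pow_left₀ hp h.le _)
    ⟨.nil, mem_treesOfHeightLE.2 (Nat.zero_le k), ?_⟩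
  exact pow_lt_pow_left₀ h hp BinaryTree.nil.numLeaves_pos.ne'

theorem exists_treePoly_eq_one (k : ℕ) : ∃ p : ℝ, 0 < p ∧ treePoly k p = 1 := by
  have hc : ContinuousOn (treePoly k) (Set.Icc 0 1) := by
    have : Continuous (treePoly k) := by unfold treePoly; fun_prop
    exact this.continuousOn
  have h0 : treePoly k 0 = 0 := by
    rw [treePoly_eq_sum]
    exact Finset.sum_eq_zero fun T _ => zero_pow T.numLeaves_pos.ne'
  have h1 : 1 ≤ treePoly k 1 := by
    cases k with
    | zero => rw [treePoly_zero]
    | succ k => rw [treePoly_succ]; nlinarith [sq_nonneg (treePoly k 1)]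
  obtain ⟨p, hp, h⟩ := intermediate_value_Icc zero_le_one hc
    (show (1 : ℝ) ∈ Set.Icc (treePoly k 0) (treePoly k 1) from ⟨by rw [h0]; norm_num, h1⟩)
  refine ⟨p, lt_of_le_of_ne hp.1 ?_, h⟩
  rintro rfl
  rw [h0] at h
  norm_num at h

/-- The bound `1/2` is the fixed point of `z ↦ 1/4 + z ^ 2`. -/
theorem treePoly_quarter_le (k : ℕ) : 0 ≤ treePoly k (1 / 4) ∧ treePoly k (1 / 4) ≤ 1 / 2 := by
  induction k with
  | zero => rw [treePoly_zero]; norm_num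
  | succ k ih =>
    rw [treePoly_succ]
    constructor <;> nlinarith

/-- Since `z ^ 2 + p - z = (z - 1/2) ^ 2 + (p - 1/4)`, each iteration gains at least `p - 1/4`. -/
theorem le_treePoly {p : ℝ} (hp : 1 / 4 < p) (k : ℕ) : k * (p - 1 / 4) ≤ treePoly k p := by
  induction k with
  | zero => rw [treePoly_zero]; simp; linarith
  | succ k ih =>
    rw [treePoly_succ]
    push_cast
    nlinarith [sq_nonneg (treePoly k p - 1 / 2)]

theorem tendsto_of_treePoly_eq_one {p : ℕ → ℝ} (hp : ∀ k, 0 < p k ∧ treePoly k (p k) = 1) :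
    Tendsto p atTop (𝓝 (1 / 4)) := by
  have hlow : ∀ k, 1 / 4 ≤ p k := by
    intro k
    by_contra! hc
    have := treePoly_strictMonoOn k (hp k).1.le (by norm_num) hc
    linarith [(hp k).2, (treePoly_quarter_le k).2]
  rw [Metric.tendsto_atTop]
  intro ε hε
  obtain ⟨N, hN⟩ := exists_nat_gt (1 / (ε / 2))
  refine ⟨N, fun k hk => ?_⟩
  have hk' : (N : ℝ) ≤ k := by exact_mod_cast hk
  -- Otherwise monotonicity and linear growth would give `1 ≥ k * (ε / 2)`, against the choice of
  -- `N`.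
  have hlt : p k < 1 / 4 + ε / 2 := by
    by_contra! hc
    have h1 := (treePoly_strictMonoOn k).monotoneOn (a := 1 / 4 + ε / 2) (b := p k)
      (by simp only [Set.mem_Ici]; positivity) (hp k).1.le hc
    have h2 := le_treePoly (p := 1 / 4 + ε / 2) (by linarith) k
    rw [div_lt_iff₀ (by positivity)] at hN
    rw [(hp k).2] at h1
    nlinarith
  rw [Real.dist_eq, abs_lt]
  constructor <;> linarith [hlow k]

end Thompson

theorem isoperimetricConstant_le {G : Type*} [Group G] (gens : Set G) {S : Set G} (hS : S.Finite)
    (hne : S.Nonempty) : isoperimetricConstant gens ≤ boundaryRatio gens S :=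
  csInf_le ⟨0, by rintro _ ⟨S, -, -, rfl⟩; exact div_nonneg (Nat.cast_nonneg _) (Nat.cast_nonneg _)⟩
    ⟨S, hS, hne, rfl⟩

/-- The isoperimetric constant of Thompson's group `F` with respect to `{x₀, x₁}` is at most `1/2`;
indeed, the sets `S_{n,k}` are finite and nonempty, `|δS_{n,k}| / |S_{n,k}| → 2 p_k` as `n → ∞`,
where `p_k` is the unique positive root of `t_k(p) = 1`, and `p_k → 1/4` as `k → ∞`. -/
theorem theorem5p3p2 :
    isoperimetricConstant ({Thompson.x0, Thompson.x1} : Set Thompson.F) ≤ 1 / 2 ∧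
    (∀ n k : ℕ, (Thompson.S n k).Finite ∧ (Thompson.S n k).Nonempty) ∧
    ∃ p : ℕ → ℝ,
      (∀ k : ℕ, 0 < p k ∧ Thompson.treePoly k (p k) = 1 ∧
        ∀ q : ℝ, 0 < q → Thompson.treePoly k q = 1 → q = p k) ∧
      (∀ k : ℕ, Tendsto
        (fun n : ℕ => boundaryRatio ({Thompson.x0, Thompson.x1} : Set Thompson.F) (Thompson.S n k))
        atTop (𝓝 (2 * p k))) ∧
      Tendsto p atTop (𝓝 (1 / 4)) := by
  choose p hp using Thompson.exists_treePoly_eq_one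
  have hlim := fun k => Thompson.boundaryRatio_S_tendsto (hp k).1 (hp k).2
  have hp4 := Thompson.tendsto_of_treePoly_eq_one hp
  refine ⟨?_, fun n k => ⟨Thompson.S_finite n k, Thompson.S_nonempty n k⟩, p,
    fun k => ⟨(hp k).1, (hp k).2, fun q hq h => ?_⟩, hlim, hp4⟩
  · have h1 : ∀ k, isoperimetricConstant ({Thompson.x0, Thompson.x1} : Set Thompson.F) ≤ 2 * p k :=
      fun k => ge_of_tendsto (hlim k) (Eventually.of_forall fun n =>
        isoperimetricConstant_le _ (Thompson.S_finite n k) (Thompson.S_nonempty n k))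
    have h2 := ge_of_tendsto (hp4.const_mul 2) (Eventually.of_forall h1)
    linarith
  · exact (Thompson.treePoly_strictMonoOn k).injOn hq.le (hp k).1.le (h.trans (hp k).2.symm)
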